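/- Let $\mathcal P=(S,\to,\mathit{IS},\mathit{AP},L)$ be a probabilistic automaton: $S$ is a finite set of states, $\to\ \subseteq S\times\mathit{Dist}(S)$ is a transition relation such that every state has at least one and at most finitely many outgoing transitions, $\mathit{IS}\subseteq S$, $\mathit{AP}$ is a set, and $L:S\to 2^{\mathit{AP}}$. *Schedulers.* A path is an infinite sequence $\omega=\omega[0]\omega[1]\dots$ of states such that for every $k$ there is $\omega[k]\to\mu$ with $\mu(\omega[k+1])>0$. A scheduler $\sigma$ maps every finite history $s_0\dots s_k$ to a probability distribution on the transitions leaving $s_k$. With a starting state $s$ it induces the probability measure $\mathrm{Prob}_{\sigma,s}$ on paths from $s$ under which, after the history $s_0\dots s_k$, the next state is $t$ with probability $\sum_{(s_k,\mu)\in\to}\sigma(s_0\dots s_k)(s_k,\mu)\cdot\mu(t)$. *Logic.* PCTL$^*$ state formulae $\varphi$ and path formulae $\psi$ are given by $$\varphi::=a\mid\varphi\wedge\varphi\mid\neg\varphi\mid\mathbb P_{\bowtie q}(\psi),\qquad \psi::=\varphi\mid\psi\wedge\psi\mid\neg\psi\mid\mathsf X\psi\mid\psi\,\mathsf U\,\psi,$$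 with $a\in\mathit{AP}$, $\bowtie\,\in\{<,>,\le,\ge\}$, $q\in[0,1]$. Path formulae are interpreted as in LTL (a state formula is evaluated at $\omega[0]$), $s\models a$ iff $a\in L(s)$, and $s\models\mathbb P_{\bowtie q}(\psi)$ iff $\mathrm{Prob}_{\sigma,s}(\{\omega\mid\omega\models\psi\})\bowtie q$ for every scheduler $\sigma$. The depth of an until-free path formula is the maximal nesting of $\mathsf X$: state formulae have depth $0$, $\wedge$ takes the maximum, $\neg$ preserves the depth, $\mathsf X$ adds $1$. PCTL$^{*-}_i$ consists of the until-free state formulae in which every path formula that occurs has depth at most $i$. Two states are equivalent for a logic if they satisfy the same state formulae of it. *Bisimulations.* For a pre-order $\mathcal R$ on $S$, a set $C\subseteq S$ is $\mathcal R$ downward closed if $C=\{s'\mid s'\,\mathcal R\,s\text{ for some }s\in C\}$. A pre-order $\mathcal R$ is a strong $1$-depth bisimulation if $s\,\mathcal R\,r$ implies $L(s)=L(r)$ and, for every $\mathcal R$ downward closed $C$: for each $s\to\mu$ with $\mu(C)>0$ there is $r\to\mu'$ with $\mu'(C)\ge\mu(C)$, and for each $r\to\mu$ with $\mu(C)>0$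 there is $s\to\mu'$ with $\mu'(C)\ge\mu(C)$. Write $s\sim_1 r$ if some strong $1$-depth bisimulation relates $s$ to $r$. An $\mathcal R$ downward closed path of length $n\ge1$ is a sequence $\Omega=C_0C_1\dots C_n$ of $\mathcal R$ downward closed sets. For a set $\tilde\Omega$ of such sequences, $C_{\tilde\Omega}$ is the set of paths $\omega$ for which there is $C_0\dots C_n\in\tilde\Omega$ with $\omega[k]\in C_k$ for all $0\le k\le n$, and $l(\tilde\Omega)$ is the maximal length of an element of $\tilde\Omega$. For $i>1$, a pre-order $\mathcal R$ is a strong $i$-depth bisimulation if $s\,\mathcal R\,r$ implies $s\sim_{i-1}r$ and, for every $\tilde\Omega$ with $l(\tilde\Omega)=i$: for each scheduler $\sigma$ with $\mathrm{Prob}_{\sigma,s}(C_{\tilde\Omega})>0$ there is a scheduler $\sigma'$ with $\mathrm{Prob}_{\sigma',r}(C_{\tilde\Omega})\ge\mathrm{Prob}_{\sigma,s}(C_{\tilde\Omega})$, and likewise with $s$ and $r$ exchanged. Write $s\sim_i r$ if some strong $i$-depth bisimulation relates $s$ to $r$, and let ${\sim}=\bigcap_{i\ge1}{\sim_i}$.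 **Theorem.** For every $i\ge1$, PCTL$^{*-}_i$ equivalence on $S$ coincides with $\sim_i$; moreover, PCTL$^*$ equivalence on $S$ coincides with $\sim$. -/

import Mathlib

open MeasureTheory ProbabilityTheory

universe u v

noncomputable section

/-- A probabilistic automaton `(S, →, IS, AP, L)`; `step` is the transition relation `→`, a set of
pairs of a state and a discrete probability distribution on states. It is image-finite. -/
structure ProbAutomaton (S : Type u) (AP : Type v) where
  step : Set (S × PMF S)
  init : Set S
  label : S → Set AP
  imageFinite : ∀ s, {μ | (s, μ) ∈ step}.Finite

namespace ProbAutomaton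

variable {S : Type u} {AP : Type v}

/-- The infinite paths `ω = ω[0] ω[1] …` that start in `s`. -/
def paths (P : ProbAutomaton S AP) (s : S) : Set (ℕ → S) :=
  {ω | ω 0 = s ∧ ∀ i, ∃ μ, (ω i, μ) ∈ P.step ∧ 0 < μ (ω (i + 1))}

/-- A (history-dependent, randomized) scheduler: given a finite history `h = s₀ … sₙ`, it chooses
a distribution over the transitions, supported by transitions that leave the last state `sₙ`. -/
structure Scheduler (P : ProbAutomaton S AP) where
  choice : (n : ℕ) → ((Finset.Iic n) → S) → PMF P.step
  source_eq : ∀ (n : ℕ) (h : (Finset.Iic n) → S) (t : P.step), 0 < choice n h t →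
    t.1.1 = h ⟨n, Finset.mem_Iic.2 le_rfl⟩

namespace Scheduler

variable {P : ProbAutomaton S AP}

/-- The distribution of the next state after the history `h`:
`s' ↦ ∑ over transitions (s, μ) of σ(h)(s, μ) · μ(s')`. -/
def next (σ : P.Scheduler) (n : ℕ) (h : (Finset.Iic n) → S) : PMF S :=
  (σ.choice n h).bind fun t => t.1.2

variable [Finite S] [MeasurableSpace S] [DiscreteMeasurableSpace S]

/-- The one-step kernels of a scheduler. -/
def kernel (σ : P.Scheduler) (n : ℕ) : Kernel ((i : Finset.Iic n) → (fun _ : ℕ => S) i) S :=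
  Kernel.ofFunOfCountable fun h => (σ.next n h).toMeasure

instance (σ : P.Scheduler) (n : ℕ) : IsMarkovKernel (σ.kernel n) :=
  ⟨fun h => PMF.toMeasure.isProbabilityMeasure (σ.next n h)⟩

/-- The probability measure on infinite state sequences induced by the scheduler `σ` and the
starting state `s` (Ionescu-Tulcea). -/
def measure (σ : P.Scheduler) (s : S) : Measure (ℕ → S) :=
  Kernel.traj (X := fun _ => S) σ.kernel 0 (fun _ => s)

end Scheduler

end ProbAutomaton

/-- The comparisons `<`, `>`, `≤`, `≥`. -/
inductive Comparison
  | lt | gt | le | ge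

/-- `c.holds x q` means `x ⋈ q`, where `⋈` is the comparison `c`. -/
def Comparison.holds : Comparison → ℝ → ℝ → Prop
  | .lt, x, q => x < q
  | .gt, x, q => x > q
  | .le, x, q => x ≤ q
  | .ge, x, q => x ≥ q

mutual

/-- PCTL* state formulae. -/
inductive StateFormula (AP : Type v) : Type v
  | atom (a : AP) : StateFormula AP
  | and (φ₁ φ₂ : StateFormula AP) : StateFormula AP
  | not (φ : StateFormula AP) : StateFormula AP
  | prob (c : Comparison) (q : Set.Icc (0 : ℝ) 1) (ψ : PathFormula AP) : StateFormula AP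

/-- PCTL* path formulae. -/
inductive PathFormula (AP : Type v) : Type v
  | state (φ : StateFormula AP) : PathFormula AP
  | and (ψ₁ ψ₂ : PathFormula AP) : PathFormula AP
  | not (ψ : PathFormula AP) : PathFormula AP
  | next (ψ : PathFormula AP) : PathFormula AP
  | until (ψ₁ ψ₂ : PathFormula AP) : PathFormula AP

end

/-- The number of nested next operators of a path formula. A state formula has depth `0`, whatever
occurs inside it. The depth is used for until-free formulae only. -/
def PathFormula.depth {AP : Type v} : PathFormula AP → ℕ
  | .state _ => 0
  | .and ψ₁ ψ₂ => max ψ₁.depth ψ₂.depth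
  | .not ψ => ψ.depth
  | .next ψ => 1 + ψ.depth
  | .until ψ₁ ψ₂ => max ψ₁.depth ψ₂.depth

mutual

/-- Membership of a state formula in the fragment of depth `i`: there is no until operator, and
every path formula that occurs has depth at most `i`. -/
def StateFormula.InFragment {AP : Type v} (i : ℕ) : StateFormula AP → Prop
  | .atom _ => True
  | .and φ₁ φ₂ => φ₁.InFragment i ∧ φ₂.InFragment i
  | .not φ => φ.InFragment i
  | .prob _ _ ψ => ψ.depth ≤ i ∧ ψ.InFragment i

/-- The path formula has no until operator, and every path formula that occurs in one of its state
subformulae has depth at most `i`. -/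
def PathFormula.InFragment {AP : Type v} (i : ℕ) : PathFormula AP → Prop
  | .state φ => φ.InFragment i
  | .and ψ₁ ψ₂ => ψ₁.InFragment i ∧ ψ₂.InFragment i
  | .not ψ => ψ.InFragment i
  | .next ψ => ψ.InFragment i
  | .until _ _ => False

end

namespace ProbAutomaton

variable {S : Type u} {AP : Type v}

section Satisfaction

variable [Finite S] [MeasurableSpace S] [DiscreteMeasurableSpace S]

mutual

/-- `s ⊨ φ` for a state formula. -/
def Sat (P : ProbAutomaton S AP) : StateFormula AP → S → Prop
  | .atom a, s => a ∈ P.label s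
  | .and φ₁ φ₂, s => P.Sat φ₁ s ∧ P.Sat φ₂ s
  | .not φ, s => ¬ P.Sat φ s
  | .prob c q ψ, s => ∀ σ : P.Scheduler,
      c.holds ((σ.measure s).real {ω | ω ∈ P.paths s ∧ P.PathSat ψ ω}) q

/-- `ω ⊨ ψ` for a path formula; `fun n => ω (j + n)` is the suffix of `ω` that starts at `ω[j]`. -/
def PathSat (P : ProbAutomaton S AP) : PathFormula AP → (ℕ → S) → Prop
  | .state φ, ω => P.Sat φ (ω 0)
  | .and ψ₁ ψ₂, ω => P.PathSat ψ₁ ω ∧ P.PathSat ψ₂ ω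
  | .not ψ, ω => ¬ P.PathSat ψ ω
  | .next ψ, ω => P.PathSat ψ (fun n => ω (1 + n))
  | .until ψ₁ ψ₂, ω => ∃ j, P.PathSat ψ₂ (fun n => ω (j + n)) ∧
      ∀ k < j, P.PathSat ψ₁ (fun n => ω (k + n))

end

/-- PCTL* equivalence of states. -/
def EquivPCTLStar (P : ProbAutomaton S AP) (s r : S) : Prop :=
  ∀ φ : StateFormula AP, P.Sat φ s ↔ P.Sat φ r

/-- Equivalence of states with respect to the until-free fragment of PCTL* of depth `i`. -/
def EquivFragment (P : ProbAutomaton S AP) (i : ℕ) (s r : S) : Prop :=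
  ∀ φ : StateFormula AP, φ.InFragment i → (P.Sat φ s ↔ P.Sat φ r)

end Satisfaction

/-- `C` is `R` downward closed: `C = {s' | s' R s for some s ∈ C}`. -/
def DownClosed (R : S → S → Prop) (C : Set S) : Prop :=
  C = {s' | ∃ s ∈ C, R s' s}

/-- A pre-order `R` is a strong 1-depth bisimulation. -/
structure IsOneDepthBisim (P : ProbAutomaton S AP) (R : S → S → Prop) : Prop where
  preorder : IsPreorder S R
  label_eq : ∀ s r, R s r → P.label s = P.label r
  forth : ∀ s r, R s r → ∀ C, DownClosed R C → ∀ μ : PMF S, (s, μ) ∈ P.step →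
    0 < μ.toOuterMeasure C →
      ∃ μ' : PMF S, (r, μ') ∈ P.step ∧ μ'.toOuterMeasure C ≥ μ.toOuterMeasure C
  back : ∀ s r, R s r → ∀ C, DownClosed R C → ∀ μ : PMF S, (r, μ) ∈ P.step →
    0 < μ.toOuterMeasure C →
      ∃ μ' : PMF S, (s, μ') ∈ P.step ∧ μ'.toOuterMeasure C ≥ μ.toOuterMeasure C

/-- A finite sequence `C₀ C₁ … Cₙ` of sets of states; its length `n` is the number of steps. -/
abbrev SetPath (S : Type u) : Type u := Σ n : ℕ, Fin (n + 1) → Set S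

/-- The `R` downward closed paths of arbitrary length `n ≥ 1`. -/
def closedSetPaths (R : S → S → Prop) : Set (SetPath S) :=
  {Ω | 1 ≤ Ω.1 ∧ ∀ k, DownClosed R (Ω.2 k)}

/-- The union of the cones of a set of set-paths: the paths `ω` from `s` such that, for some
`C₀ … Cₙ` in the set, `ω[k] ∈ Cₖ` for all `k ≤ n`. -/
def coneFrom (P : ProbAutomaton S AP) (s : S) (Ωs : Set (SetPath S)) : Set (ℕ → S) :=
  {ω | ω ∈ P.paths s ∧ ∃ Ω ∈ Ωs, ∀ k : Fin (Ω.1 + 1), ω k ∈ Ω.2 k}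

section Bisimulation

variable [Finite S] [MeasurableSpace S] [DiscreteMeasurableSpace S]

/-- A pre-order `R` is a strong `i`-depth bisimulation over the relation `prev` (which is
`(i-1)`-depth bisimilarity). -/
structure IsDepthBisim (P : ProbAutomaton S AP) (i : ℕ) (prev : S → S → Prop)
    (R : S → S → Prop) : Prop where
  preorder : IsPreorder S R
  le_prev : ∀ s r, R s r → prev s r
  forth : ∀ s r, R s r → ∀ Ωs ⊆ closedSetPaths R, IsGreatest (Sigma.fst '' Ωs) i →
    ∀ σ : P.Scheduler, 0 < (σ.measure s).real (P.coneFrom s Ωs) →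
      ∃ σ' : P.Scheduler,
        (σ'.measure r).real (P.coneFrom r Ωs) ≥ (σ.measure s).real (P.coneFrom s Ωs)
  back : ∀ s r, R s r → ∀ Ωs ⊆ closedSetPaths R, IsGreatest (Sigma.fst '' Ωs) i →
    ∀ σ : P.Scheduler, 0 < (σ.measure r).real (P.coneFrom r Ωs) →
      ∃ σ' : P.Scheduler,
        (σ'.measure s).real (P.coneFrom s Ωs) ≥ (σ.measure r).real (P.coneFrom r Ωs)

/-- Strong `i`-depth bisimilarity `~ᵢ` for `i ≥ 1` (the value at `0` is a dummy: it is never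
used, neither in the recursion nor in the intersection below). -/
def DepthBisimilar (P : ProbAutomaton S AP) : ℕ → S → S → Prop
  | 0 => fun _ _ => True
  | 1 => fun s r => ∃ R, P.IsOneDepthBisim R ∧ R s r
  | i + 2 => fun s r => ∃ R, P.IsDepthBisim (i + 2) (P.DepthBisimilar (i + 1)) R ∧ R s r

/-- Strong bisimilarity `~`, the intersection of all `~ᵢ` with `i ≥ 1`. -/
def StrongBisimilar (P : ProbAutomaton S AP) (s r : S) : Prop :=
  ∀ i ≥ 1, P.DepthBisimilar i s r

end Bisimulation

end ProbAutomaton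

end

/-!
Write `maxProb s A` for the supremum over all schedulers of the probability of the event `A` from
the state `s`. The formulae `ℙ_{≤ q}(ψ)` determine the maximal probability of the event defined by
`ψ`, and conversely all comparisons are determined by the maximal probabilities of this event and
of its complement. For the strict comparisons this needs a scheduler that attains the maximum, which
exists because the event is recognized by a finite automaton: follow a near-optimal strategy for
the current residual event, and start afresh with another one whenever the old one has lost too
much. Each restart gains a fixed amount on average, so almost surely there are finitely many.

The events defined by formulae of the fragment of depth `i` are the events that are invariant under
replacing the first `i + 1` states by equivalent ones. A bisimulation preserves the maximal
probabilities of such events, since they are unions of cones of closed set-paths. Conversely, the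
cones are such events, hence definable, and equivalence is a bisimulation.

Since `S` is finite, all fragment equivalences coincide from some depth on. An event that is
invariant under this relation is approximated from inside, by compactness, by intersections of
decreasing sequences of invariant events of finite depth. The maximal probability is continuous
along such sequences: a limit of the conditional probabilities of near-optimal schedulers, taken
history by history, describes a scheduler that is near-optimal for the intersection.
-/

open Filter

namespace ProbAutomaton

variable {S : Type u} {AP : Type v}

/-! ### Sequences of states and schedulers -/

/-- The states visited by `ω` at the times `1, …, n`. -/
def word (ω : ℕ → S) (n : ℕ) : List S := List.ofFn fun k : Fin n => ω (k + 1)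

/-- The sequence `s ω[0] ω[1] …`. -/
def consPath (s : S) (ω : ℕ → S) : ℕ → S
  | 0 => s
  | n + 1 => ω n

/-- The suffix of `ω` that starts at time `n`. -/
def dropPath (n : ℕ) (ω : ℕ → S) : ℕ → S := fun k => ω (n + k)

/-- The sequences that start in `s` and visit the states `w` next. -/
def cylinder (s : S) (w : List S) : Set (ℕ → S) := {ω | ω 0 = s ∧ word ω w.length = w}

section Words

@[simp] lemma word_zero (ω : ℕ → S) : word ω 0 = [] := rfl

@[simp] lemma length_word (ω : ℕ → S) (n : ℕ) : (word ω n).length = n := by simp [word]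

lemma word_succ (ω : ℕ → S) (n : ℕ) : word ω (n + 1) = word ω n ++ [ω (n + 1)] := by
  rw [word, List.ofFn_succ_last]; simp [word]

lemma word_add (ω : ℕ → S) (m n : ℕ) : word ω (m + n) = word ω m ++ word (dropPath m ω) n := by
  simp [word, List.ofFn_add, dropPath, add_assoc]

lemma word_eq_word_iff {ω ω' : ℕ → S} {n : ℕ} :
    word ω n = word ω' n ↔ ∀ k < n, ω (k + 1) = ω' (k + 1) := by
  simp only [word, List.ofFn_inj, funext_iff, Fin.forall_iff]

lemma getLastD_word {ω : ℕ → S} {s : S} (h : ω 0 = s) (n : ℕ) : (word ω n).getLastD s = ω n := by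
  cases n with
  | zero => exact h.symm
  | succ n => simp [word_succ]

@[simp] lemma consPath_succ (s : S) (ω : ℕ → S) (n : ℕ) : consPath s ω (n + 1) = ω n := rfl

@[simp] lemma dropPath_apply (n : ℕ) (ω : ℕ → S) (k : ℕ) : dropPath n ω k = ω (n + k) := rfl

lemma dropPath_one_consPath (s : S) (ω : ℕ → S) : dropPath 1 (consPath s ω) = ω := by
  ext k; rw [dropPath_apply, add_comm, consPath_succ]

lemma consPath_dropPath (ω : ℕ → S) : consPath (ω 0) (dropPath 1 ω) = ω := by
  ext k
  cases k with
  | zero => rfl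
  | succ k => rw [consPath_succ, dropPath_apply, add_comm]

lemma dropPath_dropPath (m n : ℕ) (ω : ℕ → S) :
    dropPath m (dropPath n ω) = dropPath (n + m) ω := by
  ext k; simp [add_assoc]

lemma word_succ_consPath (s : S) (ω : ℕ → S) (n : ℕ) :
    word (consPath s ω) (n + 1) = ω 0 :: word ω n := by
  rw [add_comm, word_add, dropPath_one_consPath]; rfl

lemma mem_cylinder_concat {s t : S} {w : List S} {ω : ℕ → S} :
    ω ∈ cylinder s (w ++ [t]) ↔ ω ∈ cylinder s w ∧ ω (w.length + 1) = t := by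
  simp [cylinder, word_succ, and_assoc]

end Words

section Measurability

variable [MeasurableSpace S]

@[fun_prop] lemma measurable_consPath (s : S) : Measurable (consPath s) :=
  measurable_pi_lambda _ fun n => by cases n <;> simp only [consPath] <;> fun_prop

@[fun_prop] lemma measurable_dropPath (n : ℕ) : Measurable (dropPath (S := S) n) :=
  measurable_pi_lambda _ fun _ => measurable_pi_apply _

variable [Finite S] [DiscreteMeasurableSpace S]

lemma measurableSet_word (n : ℕ) (B : Set (List S)) :
    MeasurableSet {ω : ℕ → S | word ω n ∈ B} :=
  (Set.toFinite (List.ofFn (n := n) ⁻¹' B)).measurableSet.preimage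
    (f := fun (ω : ℕ → S) (k : Fin n) => ω (k + 1)) (by fun_prop)

lemma measurableSet_cylinder (s : S) (w : List S) : MeasurableSet (cylinder s w) :=
  ((measurableSet_singleton s).preimage (measurable_pi_apply 0)).inter
    (measurableSet_word w.length {w})

lemma integrable_word (ν : Measure (ℕ → S)) [IsFiniteMeasure ν] (n : ℕ) (f : List S → ℝ) :
    Integrable (fun ω => f (word ω n)) ν :=
  Integrable.comp_measurable (f := fun (ω : ℕ → S) (k : Fin n) => ω (k + 1))
    (g := f ∘ List.ofFn) .of_finite (by fun_prop)

end Measurability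

namespace Scheduler

variable {P : ProbAutomaton S AP}

/-- The distribution of the next state after the history that starts in `s` and continues with
the states `w`. -/
noncomputable def nextAfter (σ : P.Scheduler) (s : S) (w : List S) : PMF S :=
  σ.next w.length fun k => (s :: w).getD k s

lemma next_eq_nextAfter (σ : P.Scheduler) {s : S} {w : List S} {n : ℕ} {h : Finset.Iic n → S}
    (hw : w.length = n) (hh : ∀ k, h k = (s :: w).getD k s) : σ.next n h = σ.nextAfter s w := by
  subst hw; exact congrArg _ (funext hh)

lemma next_frestrictLe (σ : P.Scheduler) {s : S} {ω : ℕ → S} (hω : ω 0 = s) (n : ℕ) :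
    σ.next n (Preorder.frestrictLe (π := fun _ => S) n ω) = σ.nextAfter s (word ω n) := by
  refine σ.next_eq_nextAfter (length_word ω n) fun ⟨k, hk⟩ => ?_
  cases k with
  | zero => exact hω
  | succ k => simp [word, Nat.lt_of_succ_le (Finset.mem_Iic.1 hk)]

lemma step_of_mem_support_choice (σ : P.Scheduler) {s : S} {w : List S} {a : P.step}
    (ha : a ∈ (σ.choice w.length fun k => (s :: w).getD k s).support) :
    (w.getLastD s, a.1.2) ∈ P.step := by
  have : a.1.1 = w.getLastD s := by
    rw [σ.source_eq _ _ a (pos_iff_ne_zero.2 ha)]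
    rcases w.eq_nil_or_concat with rfl | ⟨w, t, rfl⟩ <;> simp
  rw [← this]; exact a.2

lemma exists_step_of_nextAfter_pos (σ : P.Scheduler) {s t : S} {w : List S}
    (ht : 0 < σ.nextAfter s w t) : ∃ μ : PMF S, (w.getLastD s, μ) ∈ P.step ∧ 0 < μ t := by
  obtain ⟨a, ha, hat⟩ := (PMF.mem_support_bind_iff _ _ _).1 ((PMF.mem_support_iff _ _).2 ht.ne')
  exact ⟨a.1.2, σ.step_of_mem_support_choice ha, pos_iff_ne_zero.2 hat⟩

lemma exists_step_sum_le [Fintype S] (σ : P.Scheduler) (s : S) (w : List S) (f : S → ℝ) :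
    ∃ μ : PMF S, (w.getLastD s, μ) ∈ P.step ∧
      ∑ t, (σ.nextAfter s w t).toReal * f t ≤ ∑ t, (μ t).toReal * f t := by
  let p := σ.choice w.length fun k => (s :: w).getD k s
  obtain ⟨μ, hμ, hmax⟩ := Set.exists_max_image {μ | (w.getLastD s, μ) ∈ P.step}
    (fun μ => ∑ t, (μ t).toReal * f t) (P.imageFinite _)
    (let ⟨_, ha⟩ := p.support_nonempty; ⟨_, σ.step_of_mem_support_choice ha⟩)
  have hnext (t : S) : σ.nextAfter s w t = ∑' a, p a * a.1.2 t := PMF.bind_apply _ _ _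
  have hsum (t : S) : Summable fun a => (p a).toReal * (a.1.2 t).toReal :=
    (ENNReal.summable_toReal (hnext t ▸ PMF.apply_ne_top (σ.nextAfter s w) t)).congr
      fun a => ENNReal.toReal_mul
  have hp : HasSum (fun a => (p a).toReal) 1 := by
    simpa [← ENNReal.tsum_toReal_eq p.apply_ne_top] using ENNReal.hasSum_toReal p.tsum_coe_ne_top
  have hmix : HasSum (fun a => (p a).toReal * ∑ t, (a.1.2 t).toReal * f t)
      (∑ t, (σ.nextAfter s w t).toReal * f t) := by
    simp only [Finset.mul_sum, ← mul_assoc]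
    refine hasSum_sum fun t _ => ?_
    rw [hnext, ENNReal.tsum_toReal_eq fun a => ENNReal.mul_ne_top (p.apply_ne_top a)
      (a.1.2.apply_ne_top t)]
    simp only [ENNReal.toReal_mul]
    exact (hsum t).hasSum.mul_right _
  refine ⟨μ, hμ, hasSum_le (fun a => ?_) hmix
    (by simpa using hp.mul_right (∑ t, (μ t).toReal * f t))⟩
  by_cases ha : a ∈ p.support
  · exact mul_le_mul_of_nonneg_left (hmax _ (σ.step_of_mem_support_choice ha)) ENNReal.toReal_nonneg
  · simp [(p.apply_eq_zero_iff a).2 ha]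

/-- The deterministic scheduler that takes the transition `act s w` after the history that starts
in `s` and continues with the states `w`. -/
noncomputable def ofPolicy (act : S → List S → PMF S)
    (hact : ∀ s w, (w.getLastD s, act s w) ∈ P.step) : P.Scheduler where
  choice n h :=
    let w := List.ofFn fun k : Fin n => h ⟨k + 1, Finset.mem_Iic.2 k.2⟩
    let s := h ⟨0, Finset.mem_Iic.2 n.zero_le⟩
    PMF.pure ⟨(w.getLastD s, act s w), hact s w⟩
  source_eq n h t ht := by
    obtain rfl := (PMF.mem_support_pure_iff _ _).1 ((PMF.mem_support_iff _ _).2 ht.ne')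
    cases n with
    | zero => rfl
    | succ n => simp only [List.ofFn_succ_last, List.getLastD_concat]; rfl

lemma nextAfter_ofPolicy (act : S → List S → PMF S)
    (hact : ∀ s w, (w.getLastD s, act s w) ∈ P.step) (s : S) (w : List S) :
    (ofPolicy act hact).nextAfter s w = act s w := by
  refine (PMF.pure_bind _ _).trans ?_
  simp

lemma nonempty_of_serial (serial : ∀ s, ∃ μ : PMF S, (s, μ) ∈ P.step) :
    Nonempty P.Scheduler := by
  choose d hd using serial
  exact ⟨ofPolicy (fun s w => d (w.getLastD s)) fun _ _ => hd _⟩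

lemma exists_step [h : Nonempty P.Scheduler] (s : S) : ∃ μ : PMF S, (s, μ) ∈ P.step := by
  obtain ⟨σ⟩ := h
  obtain ⟨t, ht⟩ := (σ.nextAfter s []).support_nonempty
  obtain ⟨μ, hμ, -⟩ := σ.exists_step_of_nextAfter_pos (pos_iff_ne_zero.2 ht)
  exact ⟨μ, hμ⟩

section Measure

variable [Finite S] [MeasurableSpace S] [DiscreteMeasurableSpace S]

instance (σ : P.Scheduler) (s : S) : IsProbabilityMeasure (σ.measure s) := by
  unfold Scheduler.measure; infer_instance

lemma ae_zero_eq (σ : P.Scheduler) (s : S) : ∀ᵐ ω ∂σ.measure s, ω 0 = s := by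
  have h : (σ.measure s).map (Preorder.frestrictLe (π := fun _ => S) 0) =
      Measure.dirac (fun _ => s) := by
    rw [Scheduler.measure, Kernel.traj_map_frestrictLe_apply, Kernel.partialTraj_self,
      Kernel.id_apply]
  have h' : ∀ᵐ x ∂(σ.measure s).map (Preorder.frestrictLe (π := fun _ => S) 0),
      x ⟨0, Finset.mem_Iic.2 le_rfl⟩ = s := by
    rw [h, ae_dirac_iff (p := fun x : Finset.Iic 0 → S => x ⟨0, Finset.mem_Iic.2 le_rfl⟩ = s)
      ((MeasurableSet.singleton s).preimage (measurable_pi_apply _))]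
  exact ae_of_ae_map (by fun_prop) h'

end Measure

section Integral

variable [Fintype S] [MeasurableSpace S] [DiscreteMeasurableSpace S]

lemma integral_traj_succ (σ : P.Scheduler) (n : ℕ) (h : Finset.Iic n → S) (f : S → ℝ) :
    ∫ ω, f (ω (n + 1)) ∂Kernel.traj (X := fun _ => S) σ.kernel n h =
      ∑ t, (σ.next n h t).toReal * f t := by
  have hmap : (Kernel.traj (X := fun _ => S) σ.kernel n h).map (fun ω => ω (n + 1)) =
      (σ.next n h).toMeasure := by
    rw [← Kernel.map_apply _ (by fun_prop), Kernel.map_traj_succ_self]; rfl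
  rw [← integral_map (φ := fun ω : ℕ → S => ω (n + 1))
    (measurable_pi_apply _).aemeasurable (by fun_prop), hmap,
    PMF.integral_eq_sum]
  simp only [smul_eq_mul]

lemma integral_word_succ (σ : P.Scheduler) (s : S) (n : ℕ) (f : List S → ℝ) :
    ∫ ω, f (word ω (n + 1)) ∂σ.measure s =
      ∫ ω, ∑ t, (σ.nextAfter s (word ω n) t).toReal * f (word ω n ++ [t]) ∂σ.measure s := by
  obtain ⟨w, hw⟩ : ∃ w : (Finset.Iic n → S) → List S,
      ∀ ω : ℕ → S, w (Preorder.frestrictLe (π := fun _ => S) n ω) = word ω n :=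
    ⟨fun h => List.ofFn fun k : Fin n => h ⟨k + 1, Finset.mem_Iic.2 k.2⟩, fun _ => rfl⟩
  have hint : Integrable (Function.uncurry fun h (ω : ℕ → S) => f (w h ++ [ω (n + 1)]))
      (Kernel.partialTraj (X := fun _ => S) σ.kernel 0 n (fun _ => s) ⊗ₘ
        Kernel.traj (X := fun _ => S) σ.kernel n) :=
    Integrable.comp_measurable
      (f := fun p : (Finset.Iic n → S) × (ℕ → S) => (p.1, p.2 (n + 1)))
      (g := fun p : (Finset.Iic n → S) × S => f (w p.1 ++ [p.2])) .of_finite (by fun_prop)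
  calc ∫ ω, f (word ω (n + 1)) ∂σ.measure s
      = ∫ ω, f (w (Preorder.frestrictLe (π := fun _ => S) n ω) ++ [ω (n + 1)]) ∂σ.measure s := by
        simp only [word_succ, hw]
    _ = ∫ h, ∑ t, (σ.next n h t).toReal * f (w h ++ [t])
          ∂Kernel.partialTraj (X := fun _ => S) σ.kernel 0 n (fun _ => s) := by
        refine (Kernel.integral_traj_partialTraj' (X := fun _ => S) (Nat.zero_le n)
          hint).symm.trans ?_
        simp only [fun h => σ.integral_traj_succ n h fun t => f (w h ++ [t])]
    _ = ∫ ω, ∑ t, (σ.next n (Preorder.frestrictLe (π := fun _ => S) n ω) t).toReal *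
          f (word ω n ++ [t]) ∂σ.measure s := by
        rw [← Kernel.traj_map_frestrictLe_apply, integral_map (by fun_prop) (by fun_prop)]
        simp only [hw]
        rfl
    _ = _ := by
        refine integral_congr_ae ?_
        filter_upwards [σ.ae_zero_eq s] with ω hω
        rw [σ.next_frestrictLe hω]

lemma le_integral_word (σ : P.Scheduler) (s : S) (f : List S → ℝ)
    (hf : ∀ w, f w ≤ ∑ t, (σ.nextAfter s w t).toReal * f (w ++ [t])) (n : ℕ) :
    f [] ≤ ∫ ω, f (word ω n) ∂σ.measure s := by
  induction n with
  | zero => simp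
  | succ n ih =>
    rw [integral_word_succ]
    exact ih.trans (integral_mono (integrable_word _ n f)
      (integrable_word _ n fun w => ∑ t, (σ.nextAfter s w t).toReal * f (w ++ [t]))
      fun ω => hf _)

end Integral

section AlmostSure

variable [Finite S] [MeasurableSpace S] [DiscreteMeasurableSpace S]

lemma ae_nextAfter_pos (σ : P.Scheduler) (s : S) (n : ℕ) :
    ∀ᵐ ω ∂σ.measure s, 0 < σ.nextAfter s (word ω n) (ω (n + 1)) := by
  classical
  cases nonempty_fintype S
  let f : List S → ℝ := fun w =>
    if σ.nextAfter s w.dropLast (w.getLastD s) = 0 then 1 else 0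
  have hf : ∀ w, 0 ≤ f w := fun w => by dsimp only [f]; split_ifs <;> norm_num
  have hzero : ∫ ω, f (word ω (n + 1)) ∂σ.measure s = 0 := by
    rw [integral_word_succ]
    have hterm (w : List S) : ∑ t, (σ.nextAfter s w t).toReal * f (w ++ [t]) = 0 :=
      Finset.sum_eq_zero fun t _ => by by_cases h : σ.nextAfter s w t = 0 <;> simp [f, h]
    simp only [hterm, integral_zero]
  filter_upwards [(integral_eq_zero_iff_of_nonneg (fun ω => hf _) (integrable_word _ _ f)).1 hzero]
    with ω hω
  simpa [f, word_succ, pos_iff_ne_zero] using hω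

lemma ae_mem_paths (σ : P.Scheduler) (s : S) : ∀ᵐ ω ∂σ.measure s, ω ∈ P.paths s := by
  filter_upwards [σ.ae_zero_eq s, ae_all_iff.2 (σ.ae_nextAfter_pos s)] with ω h0 hpos
  exact ⟨h0, fun n => getLastD_word h0 n ▸ σ.exists_step_of_nextAfter_pos (hpos n)⟩

lemma measureReal_paths_inter (σ : P.Scheduler) (s : S) (A : Set (ℕ → S)) :
    (σ.measure s).real {ω | ω ∈ P.paths s ∧ ω ∈ A} = (σ.measure s).real A := by
  refine measureReal_congr ?_
  filter_upwards [σ.ae_mem_paths s] with ω h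
  exact propext (and_iff_right h)

lemma measureReal_cylinder_concat (σ : P.Scheduler) (s : S) (w : List S) (t : S) :
    (σ.measure s).real (cylinder s (w ++ [t])) =
      (σ.nextAfter s w t).toReal * (σ.measure s).real (cylinder s w) := by
  classical
  cases nonempty_fintype S
  have hcyl (v : List S) : (σ.measure s).real (cylinder s v) =
      ∫ ω, (if word ω v.length = v then 1 else 0) ∂σ.measure s := by
    rw [← integral_indicator_one (measurableSet_cylinder s v)]
    refine integral_congr_ae ?_
    filter_upwards [σ.ae_zero_eq s] with ω hω
    simp [Set.indicator, cylinder, hω]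
  have hsum (v : List S) : ∑ t', (σ.nextAfter s v t').toReal *
      (if v ++ [t'] = w ++ [t] then 1 else 0) =
        (σ.nextAfter s w t).toReal * if v = w then 1 else 0 := by
    by_cases hv : v = w <;> simp [hv]
  rw [hcyl, hcyl, List.length_append, List.length_singleton,
    σ.integral_word_succ s _ fun v => if v = w ++ [t] then 1 else 0, ← integral_const_mul]
  simp only [hsum]

end AlmostSure

end Scheduler

/-! ### Invariant events -/

section DeterminedBy

variable {α : Type*} {𝓢 𝒜 : Set (Set α)} {B : Set α}

/-- The set `B` is a Boolean combination, possibly infinite, of members of `𝓢`: whether a point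
belongs to `B` depends only on the members of `𝓢` that it belongs to. -/
def DeterminedBy (𝓢 : Set (Set α)) (B : Set α) : Prop :=
  ∀ x y, (∀ A ∈ 𝓢, x ∈ A ↔ y ∈ A) → (x ∈ B ↔ y ∈ B)

lemma finite_setOf_determinedBy (h𝓢 : 𝓢.Finite) : {B | DeterminedBy 𝓢 B}.Finite := by
  refine Set.Finite.of_injOn (f := fun B => (fun x => {A ∈ 𝓢 | x ∈ A}) '' B) (t := 𝒫 𝒫 𝓢)
    ?_ ?_ h𝓢.powerset.powerset
  · rintro B - _ ⟨x, -, rfl⟩ A hA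
    exact hA.1
  · have hsub {B C : Set α} (hC : DeterminedBy 𝓢 C) (h : (fun x => {A ∈ 𝓢 | x ∈ A}) '' B =
        (fun x => {A ∈ 𝓢 | x ∈ A}) '' C) : B ⊆ C := fun x hx => by
      obtain ⟨y, hy, hyx⟩ := h.subset (Set.mem_image_of_mem _ hx)
      refine (hC y x fun A hA => ?_).1 hy
      simpa [hA] using Set.ext_iff.1 hyx A
    exact fun B hB C hC h => (hsub hC h).antisymm (hsub hB h.symm)

lemma DeterminedBy.mem_of_isSetAlgebra (hB : DeterminedBy 𝓢 B) (h𝒜 : IsSetAlgebra 𝒜)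
    (h𝓢 : 𝓢.Finite) (hsub : 𝓢 ⊆ 𝒜) : B ∈ 𝒜 := by
  classical
  let atom (x : α) : Set α := ⋂ A ∈ h𝓢.toFinset, if x ∈ A then A else Aᶜ
  have mem_atom {x y : α} : y ∈ atom x ↔ ∀ A ∈ 𝓢, x ∈ A ↔ y ∈ A := by
    simp only [atom, Set.mem_iInter, Set.Finite.mem_toFinset]
    refine forall₂_congr fun A _ => ?_
    by_cases hx : x ∈ A <;> simp [hx]
  have atom_mem (x : α) : atom x ∈ 𝒜 := h𝒜.biInter_mem _ fun A hA => by
    have := hsub (h𝓢.mem_toFinset.1 hA)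
    split_ifs
    exacts [this, h𝒜.compl_mem this]
  have finite_atoms : (atom '' B).Finite := (finite_setOf_determinedBy h𝓢).subset <| by
    rintro _ ⟨x, -, rfl⟩ y z hyz
    simp only [mem_atom]
    exact forall₂_congr fun A hA => by rw [hyz A hA]
  have eq_union : B = ⋃ C ∈ finite_atoms.toFinset, C := by
    ext y
    simp only [Set.Finite.mem_toFinset, Set.biUnion_image, Set.mem_iUnion, exists_prop]
    exact ⟨fun hy => ⟨y, hy, mem_atom.2 fun _ _ => Iff.rfl⟩,
      fun ⟨x, hx, hy⟩ => (hB x y (mem_atom.1 hy)).1 hx⟩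
  rw [eq_union]
  refine h𝒜.biUnion_mem _ fun C hC => ?_
  obtain ⟨x, -, rfl⟩ := finite_atoms.mem_toFinset.1 hC
  exact atom_mem x

lemma DeterminedBy.measurableSet [MeasurableSpace α] (hB : DeterminedBy 𝓢 B) (h𝓢 : 𝓢.Finite)
    (hmeas : ∀ A ∈ 𝓢, MeasurableSet A) : MeasurableSet B :=
  hB.mem_of_isSetAlgebra (𝒜 := {A | MeasurableSet A})
    ⟨.empty, fun _ => .compl, fun _ _ => .union⟩ h𝓢 hmeas

end DeterminedBy

section Invariance

/-- The event `A` is invariant under replacing the first `n + 1` states by `R`-related ones. -/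
def InvariantUpTo (R : S → S → Prop) (n : ℕ) (A : Set (ℕ → S)) : Prop :=
  ∀ ω ω', (∀ k ≤ n, R (ω k) (ω' k)) → (ω ∈ A ↔ ω' ∈ A)

/-- The event `A` is invariant under replacing all states by `R`-related ones. -/
def InvariantUnder (R : S → S → Prop) (A : Set (ℕ → S)) : Prop :=
  ∀ ω ω', (∀ k, R (ω k) (ω' k)) → (ω ∈ A ↔ ω' ∈ A)

variable {R R' : S → S → Prop} {n m : ℕ} {A : Set (ℕ → S)}

lemma InvariantUpTo.mono (h : InvariantUpTo R n A) (hR : ∀ s r, R' s r → R s r) (hnm : n ≤ m) :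
    InvariantUpTo R' m A :=
  fun ω ω' hω => h ω ω' fun k hk => hR _ _ (hω k (hk.trans hnm))

lemma InvariantUpTo.determinedBy (hR : ∀ s, R s s) (h : InvariantUpTo R n A) :
    DeterminedBy (Set.image2 (fun k s => {ω | R s (ω k)}) (Set.Iic n) Set.univ) A :=
  fun x y hxy => h x y fun k hk =>
    (hxy _ ⟨k, hk, x k, Set.mem_univ _, rfl⟩).1 (hR (x k))

variable [Finite S] [MeasurableSpace S] [DiscreteMeasurableSpace S]

lemma InvariantUpTo.measurableSet (h : InvariantUpTo (· = ·) n A) : MeasurableSet A :=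
  (h.determinedBy fun _ => rfl).measurableSet ((Set.finite_Iic n).image2 _ Set.finite_univ) <| by
    rintro _ ⟨k, -, s, -, rfl⟩
    exact MeasurableSet.of_discrete.preimage (measurable_pi_apply k)

lemma InvariantUnder.exists_antitone_invariantUpTo (hR : Equivalence R) (hA : InvariantUnder R A)
    (hmeas : MeasurableSet A) (ν : Measure (ℕ → S)) [IsFiniteMeasure ν] {ε : ℝ} (hε : 0 < ε) :
    ∃ K : ℕ → Set (ℕ → S), Antitone K ∧ (∀ n, InvariantUpTo R n (K n)) ∧ ⋂ n, K n ⊆ A ∧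
      ν.real A < ν.real (⋂ n, K n) + ε := by
  let _ : TopologicalSpace S := ⊥
  have : DiscreteTopology S := ⟨rfl⟩
  obtain ⟨F, hFA, hF, hνF⟩ := hmeas.exists_isClosed_lt_add (measure_ne_top ν A)
    (ENNReal.ofReal_pos.2 hε).ne'
  refine ⟨fun n => {ω | ∃ x ∈ F, ∀ k ≤ n, R (x k) (ω k)},
    fun m n hmn ω ⟨x, hx, h⟩ => ⟨x, hx, fun k hk => h k (hk.trans hmn)⟩,
    fun n ω ω' hω => ?_, ?_, ?_⟩
  · exact exists_congr fun x => and_congr_right fun _ => forall₂_congr fun k hk =>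
      ⟨fun h => hR.trans h (hω k hk), fun h => hR.trans h (hR.symm (hω k hk))⟩
  · intro ω hω
    choose x hxF hx using Set.mem_iInter.1 hω
    obtain ⟨y, hyF, hy⟩ := hF.isCompact.ultrafilter_le_nhds' ((hyperfilter ℕ).map x)
      (mem_map.2 (univ_mem' hxF))
    refine (hA y ω fun k => ?_).1 (hFA hyF)
    have hxy : ∀ᶠ n in hyperfilter ℕ, x n k = y k := by
      simpa using tendsto_pi_nhds.1 hy k
    have hk : ∀ᶠ n in hyperfilter ℕ, k ≤ n :=
      Nat.hyperfilter_le_atTop (eventually_ge_atTop k)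
    obtain ⟨n, hn, hkn⟩ := (hxy.and hk).exists
    exact hn ▸ hx n k hkn
  · calc ν.real A < (ν F + ENNReal.ofReal ε).toReal :=
          (ENNReal.toReal_lt_toReal (measure_ne_top ν A) (by finiteness)).2 hνF
      _ = ν.real F + ε := by
          rw [ENNReal.toReal_add (by finiteness) (by finiteness), ENNReal.toReal_ofReal hε.le]; rfl
      _ ≤ _ := by
          refine add_le_add_left (measureReal_mono fun ω hω => ?_) ε
          exact Set.mem_iInter.2 fun n => ⟨ω, hω, fun k _ => hR.refl _⟩

end Invariance

section Convergence

variable {Ω : Type*} [MeasurableSpace Ω] {ν : Measure Ω}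

lemma le_measureReal_frequently [IsFiniteMeasure ν] {B : ℕ → Set Ω}
    (hB : ∀ n, MeasurableSet (B n)) {c : ℝ} (hc : ∀ n, c ≤ ν.real (B n)) :
    c ≤ ν.real {x | ∃ᶠ n in atTop, x ∈ B n} := by
  have hlimsup : {x | ∃ᶠ n in atTop, x ∈ B n} = ⋂ N, ⋃ n ≥ N, B n := by
    ext x
    simp [frequently_atTop]
  rw [hlimsup, measureReal_def, ← ENNReal.ofReal_le_iff_le_toReal (by finiteness)]
  refine ge_of_tendsto' (tendsto_measure_iInter_atTop (fun N => ?_) ?_ ⟨0, measure_ne_top _ _⟩)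
    fun N => ((ENNReal.ofReal_le_iff_le_toReal (by finiteness)).2 (hc N)).trans
      (measure_mono (Set.subset_biUnion_of_mem (u := B) (le_refl N)))
  · exact (MeasurableSet.biUnion (Set.to_countable _) fun n _ => hB n).nullMeasurableSet
  · exact fun N N' hNN' => Set.biUnion_subset_biUnion_left fun n hn => hNN'.trans hn

lemma ae_eventually_eq_of_integral_le {N : ℕ → Ω → ℕ} (hmono : ∀ x, Monotone fun n => N n x)
    (hint : ∀ n, Integrable (fun x => (N n x : ℝ)) ν) {C : ℝ}
    (hC : ∀ n, ∫ x, (N n x : ℝ) ∂ν ≤ C) : ∀ᵐ x ∂ν, ∃ m, ∀ n ≥ m, N n x = N m x := by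
  have hle (n : ℕ) : ∫⁻ x, (N n x : ENNReal) ∂ν ≤ ENNReal.ofReal C := by
    rw [← lintegral_congr fun x => ENNReal.ofReal_natCast (N n x),
      ← ofReal_integral_eq_lintegral_ofReal (hint n) (.of_forall fun x => Nat.cast_nonneg _)]
    exact ENNReal.ofReal_le_ofReal (hC n)
  have hmeas (n : ℕ) : AEMeasurable (fun x => (N n x : ENNReal)) ν := by
    simpa using (hint n).aemeasurable.ennreal_ofReal
  have hsup : ∫⁻ x, ⨆ n, (N n x : ENNReal) ∂ν ≠ ⊤ := by
    rw [lintegral_iSup' hmeas (.of_forall fun x m n hmn => Nat.cast_le.2 (hmono x hmn))]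
    exact ((iSup_le hle).trans_lt ENNReal.ofReal_lt_top).ne
  filter_upwards [ae_lt_top' (AEMeasurable.iSup hmeas) hsup] with x hx
  obtain ⟨b, hb⟩ := ENNReal.exists_nat_gt hx.ne
  have hbdd : BddAbove (Set.range fun n => N n x) := ⟨b, by
    rintro _ ⟨n, rfl⟩
    exact Nat.cast_le.1 ((le_iSup (fun n => (N n x : ENNReal)) n).trans hb.le)⟩
  have htend := tendsto_atTop_ciSup (hmono x) hbdd
  rw [nhds_discrete, tendsto_pure] at htend
  obtain ⟨m, hm⟩ := eventually_atTop.1 htend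
  exact ⟨m, fun n hn => (hm n hn).trans (hm m le_rfl).symm⟩

end Convergence

/-! ### Maximal probabilities -/

section MaxProb

variable (P : ProbAutomaton S AP) [Finite S] [MeasurableSpace S] [DiscreteMeasurableSpace S]

/-- The supremum over all schedulers of the probability of the event `A` from the state `s`. -/
noncomputable def maxProb (s : S) (A : Set (ℕ → S)) : ℝ :=
  ⨆ σ : P.Scheduler, (σ.measure s).real A

lemma bddAbove_range_measureReal (s : S) (A : Set (ℕ → S)) :
    BddAbove (Set.range fun σ : P.Scheduler => (σ.measure s).real A) :=
  ⟨1, by rintro _ ⟨σ, rfl⟩; exact measureReal_le_one⟩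

lemma maxProb_nonneg (s : S) (A : Set (ℕ → S)) : 0 ≤ P.maxProb s A :=
  Real.iSup_nonneg fun _ => measureReal_nonneg

lemma maxProb_le_one (s : S) (A : Set (ℕ → S)) : P.maxProb s A ≤ 1 :=
  Real.iSup_le (fun _ => measureReal_le_one) zero_le_one

lemma maxProb_le_iff [Nonempty P.Scheduler] {s : S} {A : Set (ℕ → S)} {c : ℝ} :
    P.maxProb s A ≤ c ↔ ∀ σ : P.Scheduler, (σ.measure s).real A ≤ c :=
  ciSup_le_iff (P.bddAbove_range_measureReal s A)

variable {P}

lemma Scheduler.measureReal_le_maxProb (σ : P.Scheduler) (s : S) (A : Set (ℕ → S)) :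
    (σ.measure s).real A ≤ P.maxProb s A :=
  le_ciSup (P.bddAbove_range_measureReal s A) σ

lemma maxProb_mono {s : S} {A B : Set (ℕ → S)} (h : A ⊆ B) : P.maxProb s A ≤ P.maxProb s B :=
  Real.iSup_le (fun σ => (measureReal_mono h).trans (σ.measureReal_le_maxProb s B))
    (P.maxProb_nonneg s B)

lemma exists_lt_measureReal [Nonempty P.Scheduler] {s : S} {A : Set (ℕ → S)} {c : ℝ}
    (h : c < P.maxProb s A) : ∃ σ : P.Scheduler, c < (σ.measure s).real A :=
  exists_lt_of_lt_ciSup h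

end MaxProb

section Potential

variable {P : ProbAutomaton S AP} [Fintype S]

/-- A potential for the event `A` from `s`: a `[0, 1]`-valued function of the finite histories from
`s` (of which the initial `s` is left out) that some transition does not decrease on average, and
which is positive infinitely often only along members of `A`. It certifies that `A` has maximal
probability at least `g []`. -/
structure IsPotential (P : ProbAutomaton S AP) (s : S) (A : Set (ℕ → S)) (g : List S → ℝ) :
    Prop where
  nonneg : ∀ w, 0 ≤ g w
  le_one : ∀ w, g w ≤ 1
  exists_step_le_sum : ∀ w, ∃ μ : PMF S, (w.getLastD s, μ) ∈ P.step ∧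
    g w ≤ ∑ t, (μ t).toReal * g (w ++ [t])
  mem_of_frequently_pos : ∀ ω, ω 0 = s → (∃ᶠ n in atTop, 0 < g (word ω n)) → ω ∈ A

variable {s : S} {A B : Set (ℕ → S)} {g : List S → ℝ}

lemma IsPotential.mono (hg : IsPotential P s A g) (hAB : A ⊆ B) : IsPotential P s B g :=
  { hg with mem_of_frequently_pos := fun ω h0 h => hAB (hg.mem_of_frequently_pos ω h0 h) }

lemma IsPotential.shift (hg : IsPotential P s A g) (t : S) :
    IsPotential P t (consPath s ⁻¹' A) fun w => g (t :: w) where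
  nonneg _ := hg.nonneg _
  le_one _ := hg.le_one _
  exists_step_le_sum w := List.getLastD_cons (a := s) (b := t) ▸ hg.exists_step_le_sum (t :: w)
  mem_of_frequently_pos ω h0 h := hg.mem_of_frequently_pos _ rfl <| by
    refine (frequently_atTop.2 fun N => ?_)
    obtain ⟨n, hn, hpos⟩ := frequently_atTop.1 h N
    exact ⟨n + 1, hn.trans n.le_succ, by rwa [word_succ_consPath, h0]⟩

variable [MeasurableSpace S] [DiscreteMeasurableSpace S]

lemma Scheduler.le_measureReal_of_frequently_pos (σ : P.Scheduler) (s : S) {f : List S → ℝ}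
    (hf_le : ∀ w, f w ≤ 1) (hf : ∀ w, f w ≤ ∑ t, (σ.nextAfter s w t).toReal * f (w ++ [t]))
    (hA : ∀ᵐ ω ∂σ.measure s, (∃ᶠ n in atTop, 0 < f (word ω n)) → ω ∈ A) :
    f [] ≤ (σ.measure s).real A := by
  have hmeas (n : ℕ) : MeasurableSet {ω : ℕ → S | word ω n ∈ {w | 0 < f w}} :=
    measurableSet_word n _
  have hle (n : ℕ) : f [] ≤ (σ.measure s).real {ω | word ω n ∈ {w | 0 < f w}} := by
    rw [← integral_indicator_one (hmeas n)]
    refine (σ.le_integral_word s f hf n).trans (integral_mono (integrable_word _ n f)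
      ((integrable_const 1).indicator (hmeas n)) fun ω => ?_)
    by_cases h : 0 < f (word ω n) <;> simp [Set.indicator, h, hf_le, not_lt.1]
  exact (le_measureReal_frequently hmeas hle).trans
    (ENNReal.toReal_mono (measure_ne_top _ _) (measure_mono_ae hA))

lemma IsPotential.le_maxProb (hg : IsPotential P s A g) : g [] ≤ P.maxProb s A := by
  classical
  choose μ hμ hsum using hg.exists_step_le_sum
  let σ : P.Scheduler := .ofPolicy (fun t w => if t = s then μ w else μ (t :: w)) fun t w => by
    split_ifs with h
    exacts [h ▸ hμ w, List.getLastD_cons (a := s) (b := t) ▸ hμ (t :: w)]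
  refine (σ.le_measureReal_of_frequently_pos s hg.le_one (fun w => ?_) ?_).trans
    (σ.measureReal_le_maxProb s A)
  · simpa only [σ, Scheduler.nextAfter_ofPolicy, if_pos] using hsum w
  · filter_upwards [σ.ae_zero_eq s] with ω h0 using hg.mem_of_frequently_pos ω h0

end Potential

namespace Scheduler

variable {P : ProbAutomaton S AP} [MeasurableSpace S] [DiscreteMeasurableSpace S]

/-- The conditional probability of `A` given the history that starts in `s` and continues with the
states `w`. It is `0` if that history has probability `0`. -/
noncomputable def condProb [Finite S] (σ : P.Scheduler) (s : S) (A : Set (ℕ → S)) (w : List S) :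
    ℝ :=
  (σ.measure s)[|cylinder s w].real A

variable (σ : P.Scheduler) (s : S) (A : Set (ℕ → S))

section Finite

variable [Finite S]

lemma condProb_eq (w : List S) : σ.condProb s A w =
    ((σ.measure s).real (cylinder s w))⁻¹ * (σ.measure s).real (cylinder s w ∩ A) := by
  rw [condProb, measureReal_def, cond_apply (measurableSet_cylinder s w), ENNReal.toReal_mul,
    ENNReal.toReal_inv]
  rfl

lemma condProb_mem_Icc (w : List S) : σ.condProb s A w ∈ Set.Icc 0 1 :=
  ⟨measureReal_nonneg, measureReal_le_one⟩

lemma condProb_nil : σ.condProb s A [] = (σ.measure s).real A := by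
  have hcyl : cylinder s [] =ᵐ[σ.measure s] Set.univ := eventuallyEq_univ.2 <| by
    filter_upwards [σ.ae_zero_eq s] with ω hω using ⟨hω, rfl⟩
  rw [condProb_eq, measureReal_congr hcyl, measureReal_congr (inter_ae_eq_right_of_ae_eq_univ hcyl)]
  simp

lemma exists_mem_of_condProb_pos {w : List S} (h : 0 < σ.condProb s A w) :
    ∃ ω ∈ A, ω ∈ cylinder s w := by
  by_contra! hdisj
  have : cylinder s w ∩ A = ∅ := Set.eq_empty_of_forall_notMem fun ω hω => hdisj ω hω.2 hω.1
  simp [condProb_eq, this] at h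

end Finite

lemma condProb_le_sum [Fintype S] {A : Set (ℕ → S)} (hA : MeasurableSet A) (w : List S) :
    σ.condProb s A w ≤ ∑ t, (σ.nextAfter s w t).toReal * σ.condProb s A (w ++ [t]) := by
  let m := (σ.measure s).real (cylinder s w)
  have hcyl (t : S) : (σ.measure s).real (cylinder s (w ++ [t]) ∩ A) =
      m * ((σ.nextAfter s w t).toReal * σ.condProb s A (w ++ [t])) := by
    rw [condProb_eq, ← mul_assoc, mul_comm m, ← measureReal_cylinder_concat]
    by_cases h : (σ.measure s).real (cylinder s (w ++ [t])) = 0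
    · rw [h, zero_mul]
      exact measureReal_mono_null Set.inter_subset_left h
    · rw [mul_inv_cancel_left₀ h]
  have hsplit : cylinder s w ∩ A = ⋃ t ∈ Finset.univ, cylinder s (w ++ [t]) ∩ A := by
    ext ω; simp [mem_cylinder_concat]
  have hdisj : ((Finset.univ : Finset S) : Set S).PairwiseDisjoint
      fun t => cylinder s (w ++ [t]) ∩ A := fun t _ t' _ htt' =>
    Set.disjoint_left.2 fun ω h h' => htt' <|
      (mem_cylinder_concat.1 h.1).2.symm.trans (mem_cylinder_concat.1 h'.1).2
  rw [condProb_eq, hsplit, measureReal_biUnion_finset hdisj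
    fun t _ => (measurableSet_cylinder s _).inter hA]
  simp only [hcyl, ← Finset.mul_sum]
  rw [← mul_assoc]
  exact mul_le_of_le_one_left (Finset.sum_nonneg fun t _ =>
    mul_nonneg ENNReal.toReal_nonneg (σ.condProb_mem_Icc s A _).1) inv_mul_le_one

end Scheduler

section Limit

variable {P : ProbAutomaton S AP} [MeasurableSpace S] [DiscreteMeasurableSpace S]
  {s : S} {K : ℕ → Set (ℕ → S)} {c : ℝ}

lemma exists_isPotential_iInter [Fintype S] (hK : Antitone K)
    (hinv : ∀ n, InvariantUpTo (· = ·) n (K n)) {σ : ℕ → P.Scheduler}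
    (hc : ∀ n, c ≤ ((σ n).measure s).real (K n)) :
    ∃ g, IsPotential P s (⋂ n, K n) g ∧ c ≤ g [] := by
  have hlim (w : List S) : ∃ x ∈ Set.Icc (0 : ℝ) 1,
      Tendsto (fun n => (σ n).condProb s (K n) w) (hyperfilter ℕ) (nhds x) :=
    isCompact_Icc.ultrafilter_le_nhds' ((hyperfilter ℕ).map _)
      (mem_map.2 (univ_mem' fun n => (σ n).condProb_mem_Icc s (K n) w))
  choose g hg hlim using hlim
  refine ⟨g, ⟨fun w => (hg w).1, fun w => (hg w).2, fun w => ?_, fun ω h0 hpos => ?_⟩, ?_⟩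
  · have hstep (n : ℕ) : ∃ μ ∈ {μ | (w.getLastD s, μ) ∈ P.step}, (σ n).condProb s (K n) w ≤
        ∑ t, (μ t).toReal * (σ n).condProb s (K n) (w ++ [t]) := by
      obtain ⟨μ, hμ, hle⟩ := (σ n).exists_step_sum_le s w fun t =>
        (σ n).condProb s (K n) (w ++ [t])
      exact ⟨μ, hμ, ((σ n).condProb_le_sum s (hinv n).measurableSet w).trans hle⟩
    obtain ⟨μ, hμ, hle⟩ := (Ultrafilter.eventually_exists_mem_iff (P.imageFinite _)).1
      (Eventually.of_forall (f := hyperfilter ℕ) hstep)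
    exact ⟨μ, hμ, le_of_tendsto_of_tendsto (hlim w)
      (tendsto_finsetSum _ fun t _ => (hlim (w ++ [t])).const_mul _) hle⟩
  · refine Set.mem_iInter.2 fun m => ?_
    obtain ⟨k, hk, hpos_k⟩ := frequently_atTop.1 hpos m
    have hpos_n : ∀ᶠ n in hyperfilter ℕ, 0 < (σ n).condProb s (K n) (word ω k) :=
      (hlim (word ω k)).eventually (lt_mem_nhds hpos_k)
    obtain ⟨n, hn, hmn⟩ := (hpos_n.and (Nat.hyperfilter_le_atTop (eventually_ge_atTop m))).exists
    obtain ⟨ω', hω', h0', hword⟩ := (σ n).exists_mem_of_condProb_pos s (K n) hn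
    rw [length_word, word_eq_word_iff] at hword
    refine (hinv m ω' ω fun j hj => ?_).1 (hK hmn hω')
    cases j with
    | zero => exact h0'.trans h0.symm
    | succ j => exact hword j (hj.trans hk)
  · exact ge_of_tendsto' (hlim []) fun n => ((σ n).condProb_nil s (K n)).symm ▸ hc n

variable [Nonempty P.Scheduler]

lemma exists_isPotential [Fintype S] {A : Set (ℕ → S)} (hA : MeasurableSet A) (s : S) {ε : ℝ}
    (hε : 0 < ε) : ∃ g, IsPotential P s A g ∧ P.maxProb s A < g [] + ε := by
  obtain ⟨σ, hσ⟩ := exists_lt_measureReal (sub_lt_self (P.maxProb s A) (half_pos hε))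
  obtain ⟨K, hK, hinv, hKA, hσK⟩ := InvariantUnder.exists_antitone_invariantUpTo
    (R := (· = ·)) eq_equivalence (fun ω ω' h => by rw [funext h]) hA (σ.measure s) (half_pos hε)
  obtain ⟨g, hg, hle⟩ := exists_isPotential_iInter hK hinv
    fun n => measureReal_mono (μ := σ.measure s) (Set.iInter_subset K n)
  exact ⟨g, hg.mono hKA, by linarith⟩

variable [Finite S]

lemma le_maxProb_iInter (hK : Antitone K) (hinv : ∀ n, InvariantUpTo (· = ·) n (K n))
    (hc : ∀ n, c ≤ P.maxProb s (K n)) : c ≤ P.maxProb s (⋂ n, K n) := by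
  cases nonempty_fintype S
  refine le_of_forall_pos_sub_le fun ε hε => ?_
  choose σ hσ using fun n => exists_lt_measureReal ((sub_lt_self c hε).trans_le (hc n))
  obtain ⟨g, hg, hle⟩ := exists_isPotential_iInter hK hinv fun n => (hσ n).le
  exact hle.trans hg.le_maxProb

lemma maxProb_le_of_invariantUnder {E : S → S → Prop} (hE : Equivalence E) {r : S}
    (hmax : ∀ n B, InvariantUpTo E n B → P.maxProb s B ≤ P.maxProb r B)
    {A : Set (ℕ → S)} (hA : MeasurableSet A) (hinv : InvariantUnder E A) :
    P.maxProb s A ≤ P.maxProb r A := by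
  refine P.maxProb_le_iff.2 fun σ => le_of_forall_pos_le_add fun ε hε => ?_
  obtain ⟨K, hK, hKinv, hKA, hσK⟩ :=
    hinv.exists_antitone_invariantUpTo hE hA (σ.measure s) hε
  refine hσK.le.trans (add_le_add_left ((le_maxProb_iInter hK
    (fun n => (hKinv n).mono (fun _ _ h => h ▸ hE.refl _) le_rfl) fun n => ?_).trans
      (maxProb_mono hKA)) ε)
  exact (measureReal_mono (Set.iInter_subset K n)).trans
    ((σ.measureReal_le_maxProb s _).trans (hmax n _ (hKinv n)))

end Limit

section Recognizable

/-- Membership of a sequence in `A` can be decided by a finite automaton that reads the sequence: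
the family of all events of the form `{ω | s₁ … sₙ ω ∈ A}` is finite. -/
def Recognizable (A : Set (ℕ → S)) : Prop :=
  ∃ 𝓕 : Set (Set (ℕ → S)), 𝓕.Finite ∧ A ∈ 𝓕 ∧ ∀ s, ∀ B ∈ 𝓕, consPath s ⁻¹' B ∈ 𝓕

lemma DeterminedBy.recognizable {𝓢 : Set (Set (ℕ → S))} (h𝓢 : 𝓢.Finite)
    (hcons : ∀ s, ∀ B ∈ 𝓢, DeterminedBy 𝓢 (consPath s ⁻¹' B)) {A : Set (ℕ → S)}
    (hA : DeterminedBy 𝓢 A) : Recognizable A :=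
  ⟨{B | DeterminedBy 𝓢 B}, finite_setOf_determinedBy h𝓢, hA,
    fun s _ hB x y hxy => hB _ _ fun C hC => hcons s C hC x y hxy⟩

variable {A B : Set (ℕ → S)}

lemma recognizable_zero_mem (C : Set S) : Recognizable {ω : ℕ → S | ω 0 ∈ C} :=
  DeterminedBy.recognizable (Set.finite_singleton {ω | ω 0 ∈ C})
    (by rintro s _ rfl x y -; exact Iff.rfl) fun _ _ h => h _ (Set.mem_singleton _)

lemma Recognizable.compl : Recognizable A → Recognizable Aᶜ
  | ⟨_, hfin, hA, hcons⟩ => DeterminedBy.recognizable hfin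
    (fun s B hB _ _ h => h _ (hcons s B hB)) fun _ _ h => not_congr (h A hA)

lemma Recognizable.inter : Recognizable A → Recognizable B → Recognizable (A ∩ B)
  | ⟨_, hfinA, hA, hconsA⟩, ⟨_, hfinB, hB, hconsB⟩ => DeterminedBy.recognizable (hfinA.union hfinB)
    (fun s C hC _ _ h => h _ (hC.imp (hconsA s C) (hconsB s C)))
    fun _ _ h => and_congr (h A (.inl hA)) (h B (.inr hB))

lemma Recognizable.next : Recognizable A → Recognizable (dropPath 1 ⁻¹' A)
  | ⟨_, hfin, hA, hcons⟩ => by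
    refine DeterminedBy.recognizable (hfin.insert (dropPath 1 ⁻¹' A)) (fun s C hC x y h => ?_)
      fun _ _ h => h _ (Set.mem_insert _ _)
    rcases hC with rfl | hC
    · simpa only [Set.mem_preimage, dropPath_one_consPath] using h A (.inr hA)
    · exact h _ (.inr (hcons s C hC))

/-- The sequences with a suffix in `B` all of whose predecessors are in `A`. -/
def untilEvent (A B : Set (ℕ → S)) : Set (ℕ → S) :=
  {ω | ∃ j, dropPath j ω ∈ B ∧ ∀ k < j, dropPath k ω ∈ A}

lemma mem_untilEvent_iff {ω : ℕ → S} :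
    ω ∈ untilEvent A B ↔ ω ∈ B ∨ ω ∈ A ∧ dropPath 1 ω ∈ untilEvent A B := by
  have hzero : dropPath 0 ω = ω := by ext; simp
  constructor
  · rintro ⟨_ | j, hB, hA⟩
    · exact .inl (hzero ▸ hB)
    · refine .inr ⟨hzero ▸ hA 0 j.succ_pos, j, ?_, fun k hk => ?_⟩
      · rwa [dropPath_dropPath, add_comm]
      · rw [dropPath_dropPath, add_comm]
        exact hA _ (Nat.succ_lt_succ hk)
  · rintro (hB | ⟨hA, j, hB, hj⟩)
    · exact ⟨0, hzero.symm ▸ hB, fun k hk => absurd hk k.not_lt_zero⟩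
    · refine ⟨1 + j, by rwa [← dropPath_dropPath], fun k hk => ?_⟩
      cases k with
      | zero => exact hzero.symm ▸ hA
      | succ k =>
        rw [add_comm, ← dropPath_dropPath]
        exact hj k (by omega)

lemma Recognizable.untilEvent : Recognizable A → Recognizable B → Recognizable (untilEvent A B)
  | ⟨_, hfinA, hA, hconsA⟩, ⟨_, hfinB, hB, hconsB⟩ => by
    refine DeterminedBy.recognizable ((hfinA.union hfinB).insert (ProbAutomaton.untilEvent A B))
      (fun s C hC x y h => ?_) fun _ _ h => h _ (Set.mem_insert _ _)
    rcases hC with rfl | hC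
    · simp only [Set.mem_preimage, mem_untilEvent_iff (ω := consPath _ _), dropPath_one_consPath]
      exact or_congr (h _ (.inr (.inr (hconsB s B hB))))
        (and_congr (h _ (.inr (.inl (hconsA s A hA)))) (h _ (.inl rfl)))
    · exact h _ (.inr (hC.imp (hconsA s C) (hconsB s C)))

end Recognizable

/-! ### Attainment of maximal probabilities -/

section Attainment

lemma exists_pos_forall_lt_of_finite {F : Set ℝ} (hF : F.Finite) :
    ∃ ε > 0, ∀ a ∈ F, 0 < a → ε < a := by
  have h : ∀ᶠ ε : ℝ in nhdsWithin 0 (Set.Ioi 0), ∀ a ∈ F, 0 < a → ε < a :=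
    (eventually_all_finite hF).2 fun a _ => eventually_imp_distrib_left.2 fun ha =>
      nhdsWithin_le_nhds (gt_mem_nhds ha)
  obtain ⟨ε, h, hε⟩ := (h.and self_mem_nhdsWithin).exists
  exact ⟨ε, hε, h⟩

lemma sum_toReal_eq_one [Fintype S] (μ : PMF S) : ∑ t, (μ t).toReal = 1 := by
  rw [← ENNReal.toReal_sum fun t _ => μ.apply_ne_top t, ← tsum_fintype (L := .unconditional S),
    μ.tsum_coe, ENNReal.toReal_one]

variable {P : ProbAutomaton S AP} [Fintype S] [MeasurableSpace S] [DiscreteMeasurableSpace S]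
  {𝓕 : Set (Set (ℕ → S))}

/-- The data of the reset strategy for the events of a family `𝓕`: near-optimal potentials for all
of them, and a tolerance `tol` below every positive maximal probability and below the loss of
every suboptimal transition. -/
structure ResetPlan (P : ProbAutomaton S AP) (𝓕 : Set (Set (ℕ → S))) where
  tol : ℝ
  pot : S → Set (ℕ → S) → List S → ℝ
  tol_pos : 0 < tol
  tol_lt_maxProb : ∀ s, ∀ T ∈ 𝓕, 0 < P.maxProb s T → tol < P.maxProb s T
  maxProb_le_sum : ∀ s, ∀ T ∈ 𝓕, ∀ μ : PMF S, (s, μ) ∈ P.step →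
    P.maxProb s T ≤ ∑ t, (μ t).toReal * P.maxProb t (consPath s ⁻¹' T) + tol →
      P.maxProb s T ≤ ∑ t, (μ t).toReal * P.maxProb t (consPath s ⁻¹' T)
  preimage_mem : ∀ s, ∀ T ∈ 𝓕, consPath s ⁻¹' T ∈ 𝓕
  isPotential : ∀ s, ∀ T ∈ 𝓕, IsPotential P s T (pot s T)
  maxProb_le : ∀ s, ∀ T ∈ 𝓕, P.maxProb s T ≤ pot s T [] + tol / 2

lemma nonempty_resetPlan [Nonempty P.Scheduler] (hfin : 𝓕.Finite)
    (hcons : ∀ s, ∀ T ∈ 𝓕, consPath s ⁻¹' T ∈ 𝓕) (hmeas : ∀ T ∈ 𝓕, MeasurableSet T) :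
    Nonempty (ResetPlan P 𝓕) := by
  let succ (s : S) (T : Set (ℕ → S)) (μ : PMF S) : ℝ :=
    ∑ t, (μ t).toReal * P.maxProb t (consPath s ⁻¹' T)
  have hvalues : (⋃ s, P.maxProb s '' 𝓕).Finite := Set.finite_iUnion fun s => hfin.image _
  have hlosses : (⋃ s, ⋃ T ∈ 𝓕, (P.maxProb s T - succ s T ·) '' {μ | (s, μ) ∈ P.step}).Finite :=
    Set.finite_iUnion fun s => hfin.biUnion fun T _ => (P.imageFinite s).image _
  obtain ⟨ε, hε, hlt⟩ := exists_pos_forall_lt_of_finite (hvalues.union hlosses)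
  have hpot (s : S) (T : Set (ℕ → S)) : ∃ g, T ∈ 𝓕 →
      IsPotential P s T g ∧ P.maxProb s T ≤ g [] + ε / 2 := by
    by_cases hT : T ∈ 𝓕
    · obtain ⟨g, hg, hle⟩ := exists_isPotential (P := P) (hmeas T hT) s (half_pos hε)
      exact ⟨g, fun _ => ⟨hg, hle.le⟩⟩
    · exact ⟨0, fun h => absurd h hT⟩
  choose pot hpot using hpot
  refine ⟨ε, pot, hε, fun s T hT => hlt _ (.inl (Set.mem_iUnion.2 ⟨s, T, hT, rfl⟩)),
    fun s T hT μ hμ hle => ?_, hcons, fun s T hT => (hpot s T hT).1, fun s T hT => (hpot s T hT).2⟩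
  by_contra! hloss
  have : ε < P.maxProb s T - succ s T μ := hlt _
    (.inr (Set.mem_iUnion.2 ⟨s, Set.mem_iUnion₂.2 ⟨T, hT, μ, hμ, rfl⟩⟩)) (sub_pos.2 hloss)
  exact absurd hle (by linarith)

namespace ResetPlan

/-- The memory of the reset strategy: the current state, the event that the future has to belong
to, the potential that is being followed, which is optimal up to the tolerance, and how often a
fresh potential has been chosen. -/
structure Memory (ρ : ResetPlan P 𝓕) where
  state : S
  target : Set (ℕ → S)
  pot : List S → ℝ
  resets : ℕ
  target_mem : target ∈ 𝓕
  isPotential : IsPotential P state target pot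
  maxProb_le : P.maxProb state target ≤ pot [] + ρ.tol

variable {ρ : ResetPlan P 𝓕}

/-- The memory that starts to follow the potential of the plan `ρ` for `T`. -/
def fresh (ρ : ResetPlan P 𝓕) (s : S) {T : Set (ℕ → S)} (hT : T ∈ 𝓕) (n : ℕ) : ρ.Memory where
  state := s
  target := T
  pot := ρ.pot s T
  resets := n
  target_mem := hT
  isPotential := ρ.isPotential s T hT
  maxProb_le := (ρ.maxProb_le s T hT).trans (by linarith [ρ.tol_pos])

namespace Memory

open Classical in
/-- The memory after a move to the state `t`: the potential is kept as long as it remains optimal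
up to the tolerance. -/
noncomputable def update (m : ρ.Memory) (t : S) : ρ.Memory :=
  if h : P.maxProb t (consPath m.state ⁻¹' m.target) ≤ m.pot [t] + ρ.tol then
    ⟨t, consPath m.state ⁻¹' m.target, fun w => m.pot (t :: w), m.resets,
      ρ.preimage_mem _ _ m.target_mem, m.isPotential.shift t, h⟩
  else ρ.fresh t (ρ.preimage_mem m.state _ m.target_mem) (m.resets + 1)

@[simp] lemma update_state (m : ρ.Memory) (t : S) : (m.update t).state = t := by
  unfold update; split_ifs <;> rfl

@[simp] lemma update_target (m : ρ.Memory) (t : S) :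
    (m.update t).target = consPath m.state ⁻¹' m.target := by
  unfold update; split_ifs <;> rfl

lemma update_cases (m : ρ.Memory) (t : S) :
    ((m.update t).resets = m.resets ∧ (m.update t).pot = fun w => m.pot (t :: w)) ∨
      ((m.update t).resets = m.resets + 1 ∧ m.pot [t] + ρ.tol / 2 ≤ (m.update t).pot []) := by
  unfold update
  split_ifs with h
  · exact .inl ⟨rfl, rfl⟩
  · have := ρ.maxProb_le t _ (ρ.preimage_mem m.state _ m.target_mem)
    exact .inr ⟨rfl, by dsimp only [fresh]; linarith⟩

/-- A transition that does not decrease the potential on average. -/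
noncomputable def act (m : ρ.Memory) : PMF S := (m.isPotential.exists_step_le_sum []).choose

lemma act_mem (m : ρ.Memory) : (m.state, m.act) ∈ P.step :=
  (m.isPotential.exists_step_le_sum []).choose_spec.1

lemma pot_le_sum (m : ρ.Memory) : m.pot [] ≤ ∑ t, (m.act t).toReal * m.pot [t] :=
  (m.isPotential.exists_step_le_sum []).choose_spec.2

lemma maxProb_le_sum (m : ρ.Memory) : P.maxProb m.state m.target ≤
    ∑ t, (m.act t).toReal * P.maxProb (m.update t).state (m.update t).target := by
  simp only [update_state, update_target]
  refine ρ.maxProb_le_sum _ _ m.target_mem _ m.act_mem (m.maxProb_le.trans ?_)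
  gcongr
  refine m.pot_le_sum.trans (Finset.sum_le_sum fun t _ => ?_)
  exact mul_le_mul_of_nonneg_left (m.isPotential.shift t).le_maxProb ENNReal.toReal_nonneg

lemma pot_sub_resets_le_sum (m : ρ.Memory) : m.pot [] - ρ.tol / 2 * m.resets ≤
    ∑ t, (m.act t).toReal * ((m.update t).pot [] - ρ.tol / 2 * (m.update t).resets) :=
  calc m.pot [] - ρ.tol / 2 * m.resets
      ≤ (∑ t, (m.act t).toReal * m.pot [t]) -
          (∑ t, (m.act t).toReal) * (ρ.tol / 2 * m.resets) := by
        rw [sum_toReal_eq_one, one_mul]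
        exact sub_le_sub_right m.pot_le_sum _
    _ = ∑ t, (m.act t).toReal * (m.pot [t] - ρ.tol / 2 * m.resets) := by
        simp only [mul_sub, Finset.sum_sub_distrib, Finset.sum_mul]
    _ ≤ _ := by
        refine Finset.sum_le_sum fun t _ => mul_le_mul_of_nonneg_left ?_ ENNReal.toReal_nonneg
        rcases m.update_cases t with ⟨hresets, hpot⟩ | ⟨hresets, hpot⟩
        · rw [hresets, hpot]
        · rw [hresets]
          push_cast
          linarith

/-- The memory after the moves `w`. -/
noncomputable def run (m : ρ.Memory) (w : List S) : ρ.Memory := w.foldl update m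

@[simp] lemma run_nil (m : ρ.Memory) : m.run [] = m := rfl

lemma run_append (m : ρ.Memory) (v w : List S) : m.run (v ++ w) = (m.run v).run w :=
  List.foldl_append

lemma run_concat (m : ρ.Memory) (w : List S) (t : S) : m.run (w ++ [t]) = (m.run w).update t :=
  m.run_append w [t]

lemma run_state (m : ρ.Memory) (w : List S) : (m.run w).state = w.getLastD m.state := by
  rcases w.eq_nil_or_concat with rfl | ⟨w, t, rfl⟩
  · rfl
  · rw [List.concat_eq_append, run_concat, update_state, List.getLastD_concat]

variable {ω : ℕ → S}

lemma dropPath_mem_run_target {m : ρ.Memory} (h0 : ω 0 = m.state) (n : ℕ) :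
    dropPath n ω ∈ (m.run (word ω n)).target ↔ ω ∈ m.target := by
  induction n with
  | zero => rw [show dropPath 0 ω = ω by ext; simp, word_zero, run_nil]
  | succ n ih =>
    rw [← ih, word_succ, run_concat, update_target, Set.mem_preimage, run_state, ← h0,
      getLastD_word rfl, ← dropPath_dropPath, ← consPath_dropPath (dropPath n ω),
      dropPath_one_consPath]
    rfl

lemma monotone_resets (m : ρ.Memory) (ω : ℕ → S) :
    Monotone fun n => (m.run (word ω n)).resets :=
  monotone_nat_of_le_succ fun n => by
    rw [word_succ, run_concat]
    rcases (m.run (word ω n)).update_cases (ω (n + 1)) with ⟨h, -⟩ | ⟨h, -⟩ <;> omega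

lemma run_pot {m : ρ.Memory} (hresets : ∀ n, (m.run (word ω n)).resets = m.resets) (n : ℕ)
    (w : List S) : (m.run (word ω n)).pot w = m.pot (word ω n ++ w) := by
  induction n generalizing w with
  | zero => rfl
  | succ n ih =>
    have hsame := (hresets (n + 1)).trans (hresets n).symm
    rw [word_succ, run_concat] at hsame ⊢
    rcases (m.run (word ω n)).update_cases (ω (n + 1)) with ⟨-, hpot⟩ | ⟨hresets', -⟩
    · rw [hpot]
      dsimp only
      rw [ih, List.append_assoc, List.singleton_append]
    · omega

lemma mem_target_of_resets_eq {m : ρ.Memory} (h0 : ω 0 = m.state)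
    (hresets : ∀ n, (m.run (word ω n)).resets = m.resets)
    (hpos : ∃ᶠ n in atTop, 0 < P.maxProb (m.run (word ω n)).state (m.run (word ω n)).target) :
    ω ∈ m.target := by
  refine m.isPotential.mem_of_frequently_pos ω h0 (hpos.mono fun n hn => ?_)
  have hpot := run_pot hresets n []
  rw [List.append_nil] at hpot
  have := ρ.tol_lt_maxProb _ _ (m.run (word ω n)).target_mem hn
  linarith [(m.run (word ω n)).maxProb_le]

lemma mem_target_of_resets_eventually_eq {m : ρ.Memory} (h0 : ω 0 = m.state)
    (hresets : ∃ N, ∀ n ≥ N, (m.run (word ω n)).resets = (m.run (word ω N)).resets)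
    (hpos : ∃ᶠ n in atTop, 0 < P.maxProb (m.run (word ω n)).state (m.run (word ω n)).target) :
    ω ∈ m.target := by
  obtain ⟨N, hN⟩ := hresets
  have hrun (n : ℕ) : m.run (word ω (N + n)) = (m.run (word ω N)).run (word (dropPath N ω) n) := by
    rw [word_add, run_append]
  refine (dropPath_mem_run_target h0 N).1 (mem_target_of_resets_eq ?_ (fun n => ?_) ?_)
  · rw [run_state, ← h0, getLastD_word rfl]; rfl
  · rw [← hrun]; exact hN _ (Nat.le_add_right N n)
  · refine frequently_atTop.2 fun k => ?_
    obtain ⟨n, hn, hpos_n⟩ := frequently_atTop.1 hpos (N + k)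
    obtain ⟨j, rfl⟩ := Nat.exists_eq_add_of_le (le_of_add_le_left hn)
    exact ⟨j, by omega, by rwa [← hrun]⟩

end Memory

variable {A : Set (ℕ → S)} (ρ) (hA : A ∈ 𝓕)

/-- The scheduler that follows the potentials in the memory of the reset strategy. -/
noncomputable def scheduler : P.Scheduler :=
  .ofPolicy (fun s w => ((ρ.fresh s hA 0).run w).act) fun s w => by
    have := ((ρ.fresh s hA 0).run w).act_mem
    rwa [Memory.run_state] at this

lemma nextAfter_scheduler (s : S) (w : List S) :
    (ρ.scheduler hA).nextAfter s w = ((ρ.fresh s hA 0).run w).act :=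
  Scheduler.nextAfter_ofPolicy _ _ s w

lemma integral_resets_le (s : S) (n : ℕ) :
    ∫ ω, (((ρ.fresh s hA 0).run (word ω n)).resets : ℝ) ∂(ρ.scheduler hA).measure s ≤
      2 / ρ.tol := by
  let m (w : List S) := (ρ.fresh s hA 0).run w
  let f (w : List S) : ℝ := (m w).pot [] - ρ.tol / 2 * (m w).resets
  have hf (w : List S) : f w ≤ ∑ t, ((ρ.scheduler hA).nextAfter s w t).toReal * f (w ++ [t]) := by
    simpa only [f, m, nextAfter_scheduler, Memory.run_concat] using
      (m w).pot_sub_resets_le_sum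
  have hnonneg : 0 ≤ f [] := by
    simpa [f, m, fresh] using (ρ.isPotential s A hA).nonneg []
  have hle : f [] ≤
      1 - ρ.tol / 2 * ∫ ω, ((m (word ω n)).resets : ℝ) ∂(ρ.scheduler hA).measure s :=
    calc f [] ≤ ∫ ω, f (word ω n) ∂(ρ.scheduler hA).measure s :=
          (ρ.scheduler hA).le_integral_word s f hf n
      _ ≤ ∫ ω, (1 - ρ.tol / 2 * (m (word ω n)).resets) ∂(ρ.scheduler hA).measure s :=
          integral_mono (integrable_word _ n f)
            (integrable_word _ n fun w => 1 - ρ.tol / 2 * ((m w).resets : ℝ))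
            fun ω => sub_le_sub_right ((m (word ω n)).isPotential.le_one []) _
      _ = _ := by
          rw [integral_sub (integrable_const _)
            (integrable_word _ n fun w => ρ.tol / 2 * ((m w).resets : ℝ)), integral_const_mul]
          simp
  rw [le_div_iff₀ ρ.tol_pos]
  linarith

lemma maxProb_le_measureReal_scheduler (s : S) :
    P.maxProb s A ≤ ((ρ.scheduler hA).measure s).real A := by
  let m (w : List S) := (ρ.fresh s hA 0).run w
  refine (ρ.scheduler hA).le_measureReal_of_frequently_pos s
    (f := fun w => P.maxProb (m w).state (m w).target) (fun w => P.maxProb_le_one _ _)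
    (fun w => ?_) ?_
  · simpa only [m, nextAfter_scheduler, Memory.run_concat] using (m w).maxProb_le_sum
  · filter_upwards [(ρ.scheduler hA).ae_zero_eq s, ae_eventually_eq_of_integral_le
      (Memory.monotone_resets (ρ.fresh s hA 0))
      (fun n => integrable_word _ n fun w => ((m w).resets : ℝ)) (ρ.integral_resets_le hA s)]
      with ω h0 hresets hpos
    exact Memory.mem_target_of_resets_eventually_eq h0 hresets hpos

end ResetPlan

end Attainment

lemma exists_measureReal_eq_maxProb {P : ProbAutomaton S AP} [Finite S] [MeasurableSpace S]
    [DiscreteMeasurableSpace S] [Nonempty P.Scheduler] {A : Set (ℕ → S)} (hA : MeasurableSet A)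
    (hrec : Recognizable A) : ∃ σ : P.Scheduler, ∀ s, (σ.measure s).real A = P.maxProb s A := by
  cases nonempty_fintype S
  obtain ⟨𝓕, hfin, hmem, hcons⟩ := hrec
  obtain ⟨ρ⟩ := nonempty_resetPlan (P := P) (𝓕 := {B ∈ 𝓕 | MeasurableSet B})
    (hfin.subset fun _ hB => hB.1)
    (fun s B hB => ⟨hcons s B hB.1, measurable_consPath s hB.2⟩) fun _ hB => hB.2
  exact ⟨ρ.scheduler ⟨hmem, hA⟩, fun s => ((ρ.scheduler _).measureReal_le_maxProb s A).antisymm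
    (ρ.maxProb_le_measureReal_scheduler _ s)⟩

/-! ### Invariance of satisfaction -/

section Logic

lemma InvariantUpTo.recognizable [Finite S] {n : ℕ} {A : Set (ℕ → S)}
    (h : InvariantUpTo (· = ·) n A) : Recognizable A := by
  refine ⟨{B | InvariantUpTo (· = ·) n B}, ?_, h, fun s B hB ω ω' hω => hB _ _ ?_⟩
  · exact (finite_setOf_determinedBy ((Set.finite_Iic n).image2 _ Set.finite_univ)).subset
      fun _ hB => hB.determinedBy fun _ => rfl
  · rintro (_ | k) hk
    exacts [rfl, hω k (by omega)]

variable (P : ProbAutomaton S AP) [Finite S] [MeasurableSpace S] [DiscreteMeasurableSpace S]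

lemma recognizable_pathSat : ∀ ψ : PathFormula AP, Recognizable {ω | P.PathSat ψ ω}
  | .state φ => by
    simp only [PathSat]
    exact recognizable_zero_mem {s | P.Sat φ s}
  | .and ψ₁ ψ₂ => by
    simp only [PathSat]
    exact (recognizable_pathSat ψ₁).inter (recognizable_pathSat ψ₂)
  | .not ψ => by
    simp only [PathSat]
    exact (recognizable_pathSat ψ).compl
  | .next ψ => by
    simp only [PathSat]
    exact (recognizable_pathSat ψ).next
  | .until ψ₁ ψ₂ => by
    simp only [PathSat]
    exact (recognizable_pathSat ψ₁).untilEvent (recognizable_pathSat ψ₂)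

lemma measurableSet_pathSat : ∀ ψ : PathFormula AP, MeasurableSet {ω | P.PathSat ψ ω}
  | .state φ => by
    simp only [PathSat]
    exact measurable_pi_apply 0 (MeasurableSet.of_discrete (s := {s | P.Sat φ s}))
  | .and ψ₁ ψ₂ => by
    simp only [PathSat]
    exact (measurableSet_pathSat ψ₁).inter (measurableSet_pathSat ψ₂)
  | .not ψ => by
    simp only [PathSat]
    exact (measurableSet_pathSat ψ).compl
  | .next ψ => by
    simp only [PathSat]
    exact measurable_dropPath 1 (measurableSet_pathSat ψ)
  | .until ψ₁ ψ₂ => by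
    simp only [PathSat, Set.ofPred_exists, Set.ofPred_and, Set.ofPred_forall]
    exact .iUnion fun j => (measurable_dropPath j (measurableSet_pathSat ψ₂)).inter <|
      .iInter fun k => .iInter fun _ => measurable_dropPath k (measurableSet_pathSat ψ₁)

variable {P}

lemma sat_prob_iff {c : Comparison} {q : Set.Icc (0 : ℝ) 1} {ψ : PathFormula AP} {s : S} :
    P.Sat (.prob c q ψ) s ↔
      ∀ σ : P.Scheduler, c.holds ((σ.measure s).real {ω | P.PathSat ψ ω}) q := by
  simp only [Sat]
  exact forall_congr' fun σ => by rw [← σ.measureReal_paths_inter s {ω | P.PathSat ψ ω}]; rfl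

variable [Nonempty P.Scheduler]

lemma sat_prob_le_iff {q : Set.Icc (0 : ℝ) 1} {ψ : PathFormula AP} {s : S} :
    P.Sat (.prob .le q ψ) s ↔ P.maxProb s {ω | P.PathSat ψ ω} ≤ q :=
  sat_prob_iff.trans P.maxProb_le_iff.symm

lemma maxProb_eq_of_sat {ψ : PathFormula AP} {s r : S}
    (h : ∀ q, P.Sat (.prob .le q ψ) s ↔ P.Sat (.prob .le q ψ) r) :
    P.maxProb s {ω | P.PathSat ψ ω} = P.maxProb r {ω | P.PathSat ψ ω} := by
  simp only [sat_prob_le_iff] at h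
  exact le_antisymm ((h ⟨_, P.maxProb_nonneg r _, P.maxProb_le_one r _⟩).2 le_rfl)
    ((h ⟨_, P.maxProb_nonneg s _, P.maxProb_le_one s _⟩).1 le_rfl)

lemma forall_measureReal_lt_iff {A : Set (ℕ → S)} (hA : MeasurableSet A) (hrec : Recognizable A)
    {s : S} {c : ℝ} : (∀ σ : P.Scheduler, (σ.measure s).real A < c) ↔ P.maxProb s A < c := by
  obtain ⟨σ, hσ⟩ := exists_measureReal_eq_maxProb (P := P) hA hrec
  exact ⟨fun h => hσ s ▸ h σ, fun h σ => (σ.measureReal_le_maxProb s A).trans_lt h⟩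

lemma sat_prob_congr {c : Comparison} {q : Set.Icc (0 : ℝ) 1} {ψ : PathFormula AP} {s r : S}
    (h : P.maxProb s {ω | P.PathSat ψ ω} = P.maxProb r {ω | P.PathSat ψ ω})
    (h' : P.maxProb s {ω | P.PathSat ψ ω}ᶜ = P.maxProb r {ω | P.PathSat ψ ω}ᶜ) :
    P.Sat (.prob c q ψ) s ↔ P.Sat (.prob c q ψ) r := by
  have hA := P.measurableSet_pathSat ψ
  have hrec := P.recognizable_pathSat ψ
  have hcompl (σ : P.Scheduler) (s : S) : (σ.measure s).real {ω | P.PathSat ψ ω} =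
      1 - (σ.measure s).real {ω | P.PathSat ψ ω}ᶜ := by rw [probReal_compl_eq_one_sub hA]; ring
  rw [sat_prob_iff, sat_prob_iff]
  cases c
  case lt => simp only [Comparison.holds, forall_measureReal_lt_iff hA hrec, h]
  case le => simp only [Comparison.holds, ← P.maxProb_le_iff, h]
  case gt => simp only [Comparison.holds, hcompl, gt_iff_lt, lt_sub_comm (a := (q : ℝ)),
    forall_measureReal_lt_iff hA.compl hrec.compl, h']
  case ge => simp only [Comparison.holds, hcompl, ge_iff_le, le_sub_comm (a := (q : ℝ)),
    ← P.maxProb_le_iff, h']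

end Logic

section Congruence

variable {P : ProbAutomaton S AP} [Finite S] [MeasurableSpace S] [DiscreteMeasurableSpace S]

mutual

theorem sat_congr_of_inFragment [Nonempty P.Scheduler] {i : ℕ} {R : S → S → Prop}
    (hlabel : ∀ s r, R s r → P.label s = P.label r)
    (hmax : ∀ A, InvariantUpTo R i A → ∀ s r, R s r → P.maxProb s A = P.maxProb r A)
    {φ : StateFormula AP} (hφ : φ.InFragment i) {s r : S} (hsr : R s r) :
    P.Sat φ s ↔ P.Sat φ r := by
  match φ with
  | .atom a => simp only [Sat, hlabel s r hsr]
  | .and φ₁ φ₂ =>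
    simp only [StateFormula.InFragment] at hφ
    simp only [Sat]
    exact and_congr (sat_congr_of_inFragment hlabel hmax hφ.1 hsr)
      (sat_congr_of_inFragment hlabel hmax hφ.2 hsr)
  | .not φ =>
    simp only [StateFormula.InFragment] at hφ
    simp only [Sat]
    exact not_congr (sat_congr_of_inFragment hlabel hmax hφ hsr)
  | .prob c q ψ =>
    simp only [StateFormula.InFragment] at hφ
    have h : InvariantUpTo R i {ω | P.PathSat ψ ω} := fun ω ω' hω =>
      pathSat_congr_of_inFragment hlabel hmax hφ.2 fun k hk => hω k (hk.trans hφ.1)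
    exact sat_prob_congr (hmax _ h s r hsr) (hmax _ (fun ω ω' hω => not_congr (h ω ω' hω)) s r hsr)

theorem pathSat_congr_of_inFragment [Nonempty P.Scheduler] {i : ℕ} {R : S → S → Prop}
    (hlabel : ∀ s r, R s r → P.label s = P.label r)
    (hmax : ∀ A, InvariantUpTo R i A → ∀ s r, R s r → P.maxProb s A = P.maxProb r A)
    {ψ : PathFormula AP} (hψ : ψ.InFragment i) {ω ω' : ℕ → S}
    (hω : ∀ k ≤ ψ.depth, R (ω k) (ω' k)) : P.PathSat ψ ω ↔ P.PathSat ψ ω' := by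
  match ψ with
  | .state φ =>
    simp only [PathFormula.InFragment] at hψ
    simp only [PathSat]
    exact sat_congr_of_inFragment hlabel hmax hψ (hω 0 (Nat.zero_le _))
  | .and ψ₁ ψ₂ =>
    simp only [PathFormula.InFragment] at hψ
    simp only [PathFormula.depth] at hω
    simp only [PathSat]
    exact and_congr
      (pathSat_congr_of_inFragment hlabel hmax hψ.1 fun k hk => hω k (le_max_of_le_left hk))
      (pathSat_congr_of_inFragment hlabel hmax hψ.2 fun k hk => hω k (le_max_of_le_right hk))
  | .not ψ =>
    simp only [PathFormula.InFragment] at hψ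
    simp only [PathFormula.depth] at hω
    simp only [PathSat]
    exact not_congr (pathSat_congr_of_inFragment hlabel hmax hψ hω)
  | .next ψ =>
    simp only [PathFormula.InFragment] at hψ
    simp only [PathFormula.depth] at hω
    simp only [PathSat]
    exact pathSat_congr_of_inFragment hlabel hmax hψ fun k hk => hω (1 + k) (by omega)
  | .until _ _ => simp only [PathFormula.InFragment] at hψ

end

mutual

theorem sat_congr [Nonempty P.Scheduler] {R : S → S → Prop}
    (hlabel : ∀ s r, R s r → P.label s = P.label r)
    (hmax : ∀ A, MeasurableSet A → InvariantUnder R A →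
      ∀ s r, R s r → P.maxProb s A = P.maxProb r A)
    (φ : StateFormula AP) {s r : S} (hsr : R s r) : P.Sat φ s ↔ P.Sat φ r := by
  match φ with
  | .atom a => simp only [Sat, hlabel s r hsr]
  | .and φ₁ φ₂ =>
    simp only [Sat]
    exact and_congr (sat_congr hlabel hmax φ₁ hsr) (sat_congr hlabel hmax φ₂ hsr)
  | .not φ =>
    simp only [Sat]
    exact not_congr (sat_congr hlabel hmax φ hsr)
  | .prob c q ψ =>
    have h : InvariantUnder R {ω | P.PathSat ψ ω} := fun _ _ => pathSat_congr hlabel hmax ψ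
    have hψ := P.measurableSet_pathSat ψ
    exact sat_prob_congr (hmax _ hψ h s r hsr)
      (hmax _ hψ.compl (fun ω ω' hω => not_congr (h ω ω' hω)) s r hsr)

theorem pathSat_congr [Nonempty P.Scheduler] {R : S → S → Prop}
    (hlabel : ∀ s r, R s r → P.label s = P.label r)
    (hmax : ∀ A, MeasurableSet A → InvariantUnder R A →
      ∀ s r, R s r → P.maxProb s A = P.maxProb r A)
    (ψ : PathFormula AP) {ω ω' : ℕ → S} (hω : ∀ k, R (ω k) (ω' k)) :
    P.PathSat ψ ω ↔ P.PathSat ψ ω' := by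
  match ψ with
  | .state φ =>
    simp only [PathSat]
    exact sat_congr hlabel hmax φ (hω 0)
  | .and ψ₁ ψ₂ =>
    simp only [PathSat]
    exact and_congr (pathSat_congr hlabel hmax ψ₁ hω) (pathSat_congr hlabel hmax ψ₂ hω)
  | .not ψ =>
    simp only [PathSat]
    exact not_congr (pathSat_congr hlabel hmax ψ hω)
  | .next ψ =>
    simp only [PathSat]
    exact pathSat_congr hlabel hmax ψ fun k => hω (1 + k)
  | .until ψ₁ ψ₂ =>
    simp only [PathSat]
    exact exists_congr fun j => and_congr (pathSat_congr hlabel hmax ψ₂ fun k => hω (j + k))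
      (forall₂_congr fun l _ => pathSat_congr hlabel hmax ψ₁ fun k => hω (l + k))

end

end Congruence

/-! ### Bisimilarity preserves the fragments -/

section MaxProbComparison

variable {P : ProbAutomaton S AP} [Finite S] [MeasurableSpace S] [DiscreteMeasurableSpace S]

lemma maxProb_le_maxProb_iff [Nonempty P.Scheduler] {A : Set (ℕ → S)} (hA : MeasurableSet A)
    (hrec : Recognizable A) {s r : S} :
    P.maxProb s A ≤ P.maxProb r A ↔ ∀ σ : P.Scheduler, 0 < (σ.measure s).real A →
      ∃ σ' : P.Scheduler, (σ'.measure r).real A ≥ (σ.measure s).real A := by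
  constructor
  · intro h σ _
    obtain ⟨σ', hσ'⟩ := exists_measureReal_eq_maxProb (P := P) hA hrec
    exact ⟨σ', ((σ.measureReal_le_maxProb s A).trans h).trans_eq (hσ' r).symm⟩
  · refine fun h => P.maxProb_le_iff.2 fun σ => ?_
    rcases measureReal_nonneg.eq_or_lt with h0 | h0
    · rw [← h0]
      exact P.maxProb_nonneg r A
    · obtain ⟨σ', hσ'⟩ := h σ h0
      exact hσ'.le.trans (σ'.measureReal_le_maxProb r A)

lemma Scheduler.measure_one_mem (σ : P.Scheduler) (s : S) (C : Set S) :
    σ.measure s {ω | ω 1 ∈ C} = (σ.nextAfter s []).toOuterMeasure C := by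
  have h := congrArg (fun k : Kernel (Finset.Iic 0 → S) S => k (fun _ => s) C)
    (Kernel.map_traj_succ_self (X := fun _ => S) (κ := σ.kernel) (a := 0))
  rw [Kernel.map_apply' _ (measurable_pi_apply _) _ .of_discrete] at h
  rw [← σ.next_eq_nextAfter (n := 0) (h := fun _ => s) rfl (by simp),
    ← PMF.toMeasure_apply_eq_toOuterMeasure]
  exact h

lemma Scheduler.exists_step_measure_one_mem_le (σ : P.Scheduler) (s : S) (C : Set S) :
    ∃ μ : PMF S, (s, μ) ∈ P.step ∧ σ.measure s {ω | ω 1 ∈ C} ≤ μ.toOuterMeasure C := by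
  cases nonempty_fintype S
  have toReal_eq_sum (p : PMF S) :
      (p.toOuterMeasure C).toReal = ∑ t, (p t).toReal * C.indicator 1 t := by
    rw [PMF.toOuterMeasure_apply_fintype, ENNReal.toReal_sum fun t _ =>
      ne_top_of_le_ne_top (p.apply_ne_top t) (Set.indicator_le_self _ _ _)]
    exact Finset.sum_congr rfl fun t _ => by by_cases ht : t ∈ C <;> simp [ht]
  obtain ⟨μ, hμ, hle⟩ := σ.exists_step_sum_le s [] (C.indicator 1)
  refine ⟨μ, hμ, ?_⟩
  rw [← toReal_eq_sum, ← toReal_eq_sum, ← measure_one_mem,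
    ← PMF.toMeasure_apply_eq_toOuterMeasure] at hle
  rw [← PMF.toMeasure_apply_eq_toOuterMeasure]
  exact (ENNReal.toReal_le_toReal (measure_ne_top _ _) (measure_ne_top _ _)).1 hle

lemma exists_measure_one_mem_eq [Nonempty P.Scheduler] {s : S} {μ : PMF S}
    (hμ : (s, μ) ∈ P.step) (C : Set S) :
    ∃ σ : P.Scheduler, σ.measure s {ω | ω 1 ∈ C} = μ.toOuterMeasure C := by
  classical
  choose d hd using Scheduler.exists_step (P := P)
  refine ⟨.ofPolicy (fun t w => if (w.getLastD t, μ) ∈ P.step then μ else d (w.getLastD t))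
    fun t w => ?_, ?_⟩
  · split_ifs with h
    exacts [h, hd _]
  · rw [Scheduler.measure_one_mem, Scheduler.nextAfter_ofPolicy, List.getLastD_nil, if_pos hμ]

lemma maxProb_one_mem_le_iff [Nonempty P.Scheduler] {s r : S} {C : Set S} :
    P.maxProb s {ω | ω 1 ∈ C} ≤ P.maxProb r {ω | ω 1 ∈ C} ↔
      ∀ μ : PMF S, (s, μ) ∈ P.step → 0 < μ.toOuterMeasure C →
        ∃ μ' : PMF S, (r, μ') ∈ P.step ∧ μ'.toOuterMeasure C ≥ μ.toOuterMeasure C := by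
  have hinv : InvariantUpTo (· = ·) 1 {ω : ℕ → S | ω 1 ∈ C} := fun ω ω' h => by
    simp only [Set.mem_ofPred_eq, h 1 le_rfl]
  rw [maxProb_le_maxProb_iff hinv.measurableSet hinv.recognizable]
  simp only [measureReal_def, ENNReal.toReal_pos_iff, ge_iff_le,
    ENNReal.toReal_le_toReal (measure_ne_top _ _) (measure_ne_top _ _)]
  constructor
  · intro h μ hμ hpos
    obtain ⟨σ, hσ⟩ := exists_measure_one_mem_eq hμ C
    obtain ⟨σ', hσ'⟩ := h σ ⟨hpos.trans_eq hσ.symm, measure_lt_top _ _⟩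
    obtain ⟨μ', hμ', hle⟩ := σ'.exists_step_measure_one_mem_le r C
    exact ⟨μ', hμ', hσ.symm.le.trans (hσ'.trans hle)⟩
  · rintro h σ ⟨hpos, -⟩
    obtain ⟨μ, hμ, hle⟩ := σ.exists_step_measure_one_mem_le s C
    obtain ⟨μ', hμ', hle'⟩ := h μ hμ (hpos.trans_le hle)
    obtain ⟨σ', hσ'⟩ := exists_measure_one_mem_eq hμ' C
    exact ⟨σ', (hle.trans hle').trans_eq hσ'.symm⟩

end MaxProbComparison

section DownClosed

variable {R E : S → S → Prop} {C : Set S}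

lemma downClosed_of_forall_mem_iff (hR : ∀ s, R s s) (hC : ∀ s r, R s r → (s ∈ C ↔ r ∈ C)) :
    DownClosed R C :=
  Set.ext fun s => ⟨fun hs => ⟨s, hs, hR s⟩, fun ⟨r, hr, hsr⟩ => (hC s r hsr).2 hr⟩

lemma DownClosed.mem_iff (hC : DownClosed R C) (hR : Equivalence R) {s r : S} (h : R s r) :
    s ∈ C ↔ r ∈ C := by
  have mem_of_rel {s r : S} (h : R s r) (hr : r ∈ C) : s ∈ C := by rw [hC]; exact ⟨r, hr, h⟩
  exact ⟨mem_of_rel (hR.symm h), mem_of_rel h⟩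

/-- The set-paths of length `i` that consist of the `E`-classes of the states of a member of `A`. -/
def classPaths (E : S → S → Prop) (i : ℕ) (A : Set (ℕ → S)) : Set (SetPath S) :=
  {Ω | ∃ ω ∈ A, Ω = ⟨i, fun k => {t | E (ω k) t}⟩}

lemma classPaths_subset_closedSetPaths (hR : ∀ s, R s s) (hRE : ∀ s r, R s r → E s r)
    (hE : Equivalence E) {i : ℕ} (hi : 1 ≤ i) (A : Set (ℕ → S)) :
    classPaths E i A ⊆ closedSetPaths R := by
  rintro _ ⟨ω, -, rfl⟩
  exact ⟨hi, fun k => downClosed_of_forall_mem_iff hR fun s r hsr =>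
    ⟨fun h => hE.trans h (hRE s r hsr), fun h => hE.trans h (hE.symm (hRE s r hsr))⟩⟩

lemma isGreatest_classPaths (E : S → S → Prop) (i : ℕ) {A : Set (ℕ → S)} (hA : A.Nonempty) :
    IsGreatest (Sigma.fst '' classPaths E i A) i := by
  obtain ⟨ω, hω⟩ := hA
  refine ⟨⟨_, ⟨ω, hω, rfl⟩, rfl⟩, ?_⟩
  rintro _ ⟨_, ⟨ω', -, rfl⟩, rfl⟩
  exact le_rfl

lemma coneFrom_classPaths (P : ProbAutomaton S AP) (hE : ∀ s, E s s) {i : ℕ} {A : Set (ℕ → S)}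
    (hA : InvariantUpTo E i A) (s : S) :
    P.coneFrom s (classPaths E i A) = {ω | ω ∈ P.paths s ∧ ω ∈ A} := by
  ext ω
  refine and_congr_right fun _ => ⟨?_, fun h => ⟨_, ⟨ω, h, rfl⟩, fun k => hE _⟩⟩
  rintro ⟨_, ⟨ω', h, rfl⟩, hk⟩
  exact (hA ω' ω fun k hk' => hk ⟨k, Nat.lt_succ_of_le hk'⟩).1 h

end DownClosed

section Soundness

variable {P : ProbAutomaton S AP} [Finite S] [MeasurableSpace S] [DiscreteMeasurableSpace S]
  {E R : S → S → Prop} {A : Set (ℕ → S)} {s r : S}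

lemma InvariantUpTo.maxProb_eq_one_mem (hE : Equivalence E) (hA : InvariantUpTo E 1 A)
    (hsr : E s r) :
    P.maxProb r A = P.maxProb r {ω | ω 1 ∈ {t | consPath s (fun _ => t) ∈ A}} := by
  refine iSup_congr fun σ => measureReal_congr ?_
  filter_upwards [σ.ae_zero_eq r] with ω hω
  refine propext (hA _ _ fun k hk => ?_)
  interval_cases k
  · exact hω ▸ hE.symm hsr
  · exact hE.refl _

variable [Nonempty P.Scheduler]

lemma IsOneDepthBisim.maxProb_eq (h : P.IsOneDepthBisim R) (hE : Equivalence E)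
    (hRE : ∀ s r, R s r → E s r) (hA : InvariantUpTo E 1 A) (hsr : R s r) :
    P.maxProb s A = P.maxProb r A := by
  have hC : DownClosed R {t | consPath s (fun _ => t) ∈ A} :=
    downClosed_of_forall_mem_iff h.preorder.refl fun t t' htt' => hA _ _ fun k _ => by
      cases k with
      | zero => exact hE.refl _
      | succ k => exact hRE t t' htt'
  rw [hA.maxProb_eq_one_mem hE (hE.refl s), hA.maxProb_eq_one_mem hE (hRE s r hsr)]
  exact (maxProb_one_mem_le_iff.2 (h.forth s r hsr _ hC)).antisymm
    (maxProb_one_mem_le_iff.2 (h.back s r hsr _ hC))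

lemma IsDepthBisim.maxProb_eq {i : ℕ} (hi : 1 ≤ i) {prev : S → S → Prop}
    (h : P.IsDepthBisim i prev R) (hE : Equivalence E) (hRE : ∀ s r, R s r → E s r)
    (hA : InvariantUpTo E i A) (hsr : R s r) : P.maxProb s A = P.maxProb r A := by
  have hA' : InvariantUpTo (· = ·) i A := hA.mono (fun _ _ h => h ▸ hE.refl _) le_rfl
  rcases A.eq_empty_or_nonempty with rfl | hne
  · simp [maxProb]
  have hsub := classPaths_subset_closedSetPaths h.preorder.refl hRE hE hi A
  have hgreatest := isGreatest_classPaths E i hne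
  have hforth := h.forth s r hsr _ hsub hgreatest
  have hback := h.back s r hsr _ hsub hgreatest
  simp only [coneFrom_classPaths P hE.refl hA, Scheduler.measureReal_paths_inter] at hforth hback
  have hle {s r : S} := maxProb_le_maxProb_iff (P := P) hA'.measurableSet hA'.recognizable
    (s := s) (r := r)
  exact (hle.2 hforth).antisymm (hle.2 hback)

lemma DepthBisimilar.maxProb_eq {i : ℕ} (h : P.DepthBisimilar (i + 1) s r) (hE : Equivalence E)
    (hDE : ∀ s r, P.DepthBisimilar (i + 1) s r → E s r) (hA : InvariantUpTo E (i + 1) A) :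
    P.maxProb s A = P.maxProb r A := by
  cases i with
  | zero =>
    obtain ⟨R, hR, hsr⟩ := h
    exact hR.maxProb_eq hE (fun s r h => hDE s r ⟨R, hR, h⟩) hA hsr
  | succ i =>
    obtain ⟨R, hR, hsr⟩ := h
    exact hR.maxProb_eq (by omega) hE (fun s r h => hDE s r ⟨R, hR, h⟩) hA hsr

omit [Nonempty P.Scheduler] in
lemma DepthBisimilar.label_eq {i : ℕ} (h : P.DepthBisimilar (i + 1) s r) :
    P.label s = P.label r := by
  induction i with
  | zero =>
    obtain ⟨R, hR, hsr⟩ := h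
    exact hR.label_eq s r hsr
  | succ i ih =>
    obtain ⟨R, hR, hsr⟩ := h
    exact ih (hR.le_prev s r hsr)

theorem DepthBisimilar.equivFragment {i : ℕ} (h : P.DepthBisimilar (i + 1) s r) :
    P.EquivFragment (i + 1) s r := fun _ hφ =>
  -- Bisimilarity is not known to be transitive here, hence the equivalence that it generates.
  sat_congr_of_inFragment (R := Relation.EqvGen (P.DepthBisimilar (i + 1)))
    (fun _ _ h => congrArg (Quot.lift P.label fun _ _ h => h.label_eq) (Quot.eqvGen_sound h))
    (fun A hA _ _ h => congrArg (Quot.lift (P.maxProb · A) fun _ _ h =>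
      h.maxProb_eq (Relation.EqvGen.is_equivalence _) (fun _ _ => .rel _ _) hA)
      (Quot.eqvGen_sound h))
    hφ (.rel _ _ h)

end Soundness

/-! ### Fragment equivalence is a bisimulation -/

section Definability

mutual

theorem inFragment_mono {i j : ℕ} (hij : i ≤ j) {φ : StateFormula AP} (h : φ.InFragment i) :
    φ.InFragment j := by
  match φ with
  | .atom _ => simp only [StateFormula.InFragment]
  | .and φ₁ φ₂ =>
    simp only [StateFormula.InFragment] at h ⊢
    exact ⟨inFragment_mono hij h.1, inFragment_mono hij h.2⟩
  | .not φ =>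
    simp only [StateFormula.InFragment] at h ⊢
    exact inFragment_mono hij h
  | .prob c q ψ =>
    simp only [StateFormula.InFragment] at h ⊢
    exact ⟨h.1.trans hij, pathInFragment_mono hij h.2⟩

theorem pathInFragment_mono {i j : ℕ} (hij : i ≤ j) {ψ : PathFormula AP} (h : ψ.InFragment i) :
    ψ.InFragment j := by
  match ψ with
  | .state φ =>
    simp only [PathFormula.InFragment] at h ⊢
    exact inFragment_mono hij h
  | .and ψ₁ ψ₂ =>
    simp only [PathFormula.InFragment] at h ⊢
    exact ⟨pathInFragment_mono hij h.1, pathInFragment_mono hij h.2⟩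
  | .not ψ =>
    simp only [PathFormula.InFragment] at h ⊢
    exact pathInFragment_mono hij h
  | .next ψ =>
    simp only [PathFormula.InFragment] at h ⊢
    exact pathInFragment_mono hij h
  | .until _ _ => simp only [PathFormula.InFragment] at h

end

variable {P : ProbAutomaton S AP} [Finite S] [MeasurableSpace S] [DiscreteMeasurableSpace S]
  {i n : ℕ}

variable (P) in
lemma equivalence_equivFragment (i : ℕ) : Equivalence (P.EquivFragment i) where
  refl _ _ _ := Iff.rfl
  symm h φ hφ := (h φ hφ).symm
  trans h h' φ hφ := (h φ hφ).trans (h' φ hφ)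

lemma EquivFragment.anti {j : ℕ} (hij : i ≤ j) {s r : S} (h : P.EquivFragment j s r) :
    P.EquivFragment i s r :=
  fun φ hφ => h φ (inFragment_mono hij hφ)

lemma EquivFragment.label_eq {s r : S} (h : P.EquivFragment i s r) : P.label s = P.label r := by
  ext a
  have := h (.atom a) (by simp only [StateFormula.InFragment])
  simpa only [Sat] using this

/-- The events that are defined by a path formula of depth at most `n` whose state subformulae
belong to the fragment of depth `i`. -/
def pathDefinable (P : ProbAutomaton S AP) (i n : ℕ) : Set (Set (ℕ → S)) :=
  {A | ∃ ψ : PathFormula AP, ψ.InFragment i ∧ ψ.depth ≤ n ∧ {ω | P.PathSat ψ ω} = A}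

lemma compl_mem_pathDefinable {A : Set (ℕ → S)} (hA : A ∈ P.pathDefinable i n) :
    Aᶜ ∈ P.pathDefinable i n := by
  obtain ⟨ψ, hψ, hd, rfl⟩ := hA
  exact ⟨.not ψ, by simpa only [PathFormula.InFragment], by simpa only [PathFormula.depth],
    by simp only [PathSat]; rfl⟩

lemma inter_mem_pathDefinable {A B : Set (ℕ → S)} (hA : A ∈ P.pathDefinable i n)
    (hB : B ∈ P.pathDefinable i n) : A ∩ B ∈ P.pathDefinable i n := by
  obtain ⟨ψ, hψ, hd, rfl⟩ := hA
  obtain ⟨ψ', hψ', hd', rfl⟩ := hB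
  exact ⟨.and ψ ψ', by simpa only [PathFormula.InFragment] using ⟨hψ, hψ'⟩,
    by simpa only [PathFormula.depth] using max_le hd hd', by simp only [PathSat]; rfl⟩

lemma isSetAlgebra_pathDefinable (hne : (P.pathDefinable i n).Nonempty) :
    IsSetAlgebra (P.pathDefinable i n) where
  empty_mem := by
    obtain ⟨A, hA⟩ := hne
    exact Set.inter_compl_self A ▸ inter_mem_pathDefinable hA (compl_mem_pathDefinable hA)
  compl_mem _ := compl_mem_pathDefinable
  union_mem A B hA hB := by
    rw [← compl_compl (A ∪ B), Set.compl_union]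
    exact compl_mem_pathDefinable
      (inter_mem_pathDefinable (compl_mem_pathDefinable hA) (compl_mem_pathDefinable hB))

lemma setOf_sat_mem_pathDefinable {φ : StateFormula AP} (hφ : φ.InFragment i) {k : ℕ}
    (hk : k ≤ n) : {ω | P.Sat φ (ω k)} ∈ P.pathDefinable i n := by
  induction k generalizing n with
  | zero =>
    exact ⟨.state φ, by simpa only [PathFormula.InFragment], by simp [PathFormula.depth],
      by simp only [PathSat]⟩
  | succ k ih =>
    obtain ⟨ψ, hψ, hd, hA⟩ := ih (le_refl k)
    refine ⟨.next ψ, by simpa only [PathFormula.InFragment], ?_, ?_⟩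
    · simp only [PathFormula.depth]
      omega
    · ext ω
      simp only [PathSat]
      exact (Set.ext_iff.1 hA _).trans (by simp only [Set.mem_ofPred_eq, add_comm])

lemma InvariantUpTo.mem_pathDefinable {A : Set (ℕ → S)}
    (hA : InvariantUpTo (P.EquivFragment i) n A) (hne : (P.pathDefinable i n).Nonempty) :
    A ∈ P.pathDefinable i n := by
  let 𝓒 : Set (Set S) := {C | ∃ φ : StateFormula AP, φ.InFragment i ∧ {s | P.Sat φ s} = C}
  have hA𝓒 : DeterminedBy (Set.image2 (fun k C => {ω : ℕ → S | ω k ∈ C}) (Set.Iic n) 𝓒) A :=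
    fun x y hxy => hA x y fun k hk φ hφ => hxy _ ⟨k, hk, _, ⟨φ, hφ, rfl⟩, rfl⟩
  refine hA𝓒.mem_of_isSetAlgebra (isSetAlgebra_pathDefinable hne)
    ((Set.finite_Iic n).image2 _ 𝓒.toFinite) ?_
  rintro _ ⟨k, hk, _, ⟨φ, hφ, rfl⟩, rfl⟩
  exact setOf_sat_mem_pathDefinable hφ hk

end Definability

section Completeness

variable {P : ProbAutomaton S AP} [Finite S] [MeasurableSpace S] [DiscreteMeasurableSpace S]
  [Nonempty P.Scheduler] {i : ℕ} {s r : S}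

lemma EquivFragment.maxProb_eq {A : Set (ℕ → S)} (h : P.EquivFragment i s r)
    (hA : InvariantUpTo (P.EquivFragment i) i A) : P.maxProb s A = P.maxProb r A := by
  rcases (P.pathDefinable i i).eq_empty_or_nonempty with hempty | hne
  · have equiv_all (s r : S) : P.EquivFragment i s r := fun φ hφ =>
      (hempty.subset (setOf_sat_mem_pathDefinable hφ i.zero_le)).elim
    rcases A.eq_empty_or_nonempty with rfl | ⟨ω, hω⟩
    · simp [maxProb]
    · rw [Set.eq_univ_of_forall fun ω' => (hA ω ω' fun _ _ => equiv_all _ _).1 hω]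
      simp [maxProb]
  · obtain ⟨ψ, hψ, hd, rfl⟩ := hA.mem_pathDefinable hne
    exact maxProb_eq_of_sat fun q =>
      h (.prob .le q ψ) (by simpa only [StateFormula.InFragment] using ⟨hd, hψ⟩)

lemma isOneDepthBisim_equivFragment : P.IsOneDepthBisim (P.EquivFragment 1) := by
  have hE := P.equivalence_equivFragment 1
  have maxProb_eq {s r : S} (h : P.EquivFragment 1 s r) {C : Set S}
      (hC : DownClosed (P.EquivFragment 1) C) :
      P.maxProb s {ω | ω 1 ∈ C} = P.maxProb r {ω | ω 1 ∈ C} :=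
    h.maxProb_eq fun _ _ hω => hC.mem_iff hE (hω 1 le_rfl)
  exact ⟨{ refl := hE.refl, trans := fun _ _ _ => hE.trans }, fun _ _ => EquivFragment.label_eq,
    fun _ _ h _ hC => maxProb_one_mem_le_iff.1 (maxProb_eq h hC).le,
    fun _ _ h _ hC => maxProb_one_mem_le_iff.1 (maxProb_eq h hC).ge⟩

lemma isDepthBisim_equivFragment {prev : S → S → Prop}
    (hprev : ∀ s r, P.EquivFragment i s r → prev s r) :
    P.IsDepthBisim i prev (P.EquivFragment i) := by
  have hE := P.equivalence_equivFragment i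
  let event (Ωs : Set (SetPath S)) : Set (ℕ → S) :=
    {ω | ∃ Ω ∈ Ωs, ∀ k : Fin (Ω.1 + 1), ω k ∈ Ω.2 k}
  have hcone (σ : P.Scheduler) (s : S) (Ωs : Set (SetPath S)) :
      (σ.measure s).real (P.coneFrom s Ωs) = (σ.measure s).real (event Ωs) :=
    σ.measureReal_paths_inter s (event Ωs)
  have hinv {Ωs : Set (SetPath S)} (hΩs : Ωs ⊆ closedSetPaths (P.EquivFragment i))
      (hi : IsGreatest (Sigma.fst '' Ωs) i) : InvariantUpTo (P.EquivFragment i) i (event Ωs) :=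
    fun ω ω' hω => exists_congr fun Ω => and_congr_right fun hΩ => forall_congr' fun k =>
      ((hΩs hΩ).2 k).mem_iff hE (hω k ((Nat.le_of_lt_succ k.2).trans (hi.2 ⟨Ω, hΩ, rfl⟩)))
  have exists_scheduler {s r : S} (h : P.EquivFragment i s r) {Ωs : Set (SetPath S)}
      (hΩs : Ωs ⊆ closedSetPaths (P.EquivFragment i)) (hi : IsGreatest (Sigma.fst '' Ωs) i) :=
    have hinv_eq := (hinv hΩs hi).mono (R' := (· = ·)) (fun _ _ h => h ▸ hE.refl _) le_rfl
    (maxProb_le_maxProb_iff hinv_eq.measurableSet hinv_eq.recognizable).1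
      (h.maxProb_eq (hinv hΩs hi)).le
  refine ⟨{ refl := hE.refl, trans := fun _ _ _ => hE.trans }, hprev, ?_, ?_⟩
  · intro s r h Ωs hΩs hi
    simpa only [hcone] using exists_scheduler h hΩs hi
  · intro s r h Ωs hΩs hi
    simpa only [hcone] using exists_scheduler (hE.symm h) hΩs hi

theorem EquivFragment.depthBisimilar (h : P.EquivFragment (i + 1) s r) :
    P.DepthBisimilar (i + 1) s r := by
  induction i generalizing s r with
  | zero => exact ⟨_, isOneDepthBisim_equivFragment, h⟩
  | succ i ih => exact ⟨_, isDepthBisim_equivFragment fun s r h => ih (h.anti (i + 1).le_succ), h⟩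

omit [Nonempty P.Scheduler] in
variable (P) in
lemma exists_forall_equivFragment :
    ∃ m, ∀ s r, P.EquivFragment m s r → ∀ i, P.EquivFragment i s r := by
  cases nonempty_fintype S
  have h (p : S × S) : ∃ n, P.EquivFragment n p.1 p.2 → ∀ i, P.EquivFragment i p.1 p.2 := by
    by_cases hp : ∀ i, P.EquivFragment i p.1 p.2
    · exact ⟨0, fun _ => hp⟩
    · push Not at hp
      exact hp.imp fun n hn hn' => absurd hn' hn
  choose n hn using h
  exact ⟨Finset.univ.sup n, fun s r hsr => hn (s, r)
    (hsr.anti (Finset.le_sup (f := n) (Finset.mem_univ (s, r))))⟩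

theorem equivPCTLStar_of_forall_equivFragment (h : ∀ i, P.EquivFragment i s r) :
    P.EquivPCTLStar s r := by
  obtain ⟨m, hm⟩ := P.exists_forall_equivFragment
  have hE := P.equivalence_equivFragment m
  have maxProb_eq {s r : S} (hsr : P.EquivFragment m s r) (n : ℕ) {A : Set (ℕ → S)}
      (hA : InvariantUpTo (P.EquivFragment m) n A) : P.maxProb s A = P.maxProb r A :=
    (hm s r hsr (max m n)).maxProb_eq
      (hA.mono (fun _ _ h => h.anti (le_max_left m n)) (le_max_right m n))
  refine fun φ => sat_congr (fun _ _ => EquivFragment.label_eq)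
    (fun A hA hinv s r hsr => le_antisymm ?_ ?_) φ (h m)
  · exact maxProb_le_of_invariantUnder hE (fun n _ hB => (maxProb_eq hsr n hB).le) hA hinv
  · exact maxProb_le_of_invariantUnder hE (fun n _ hB => (maxProb_eq hsr n hB).ge) hA hinv

end Completeness

end ProbAutomaton

theorem mainTheorem1 {S : Type u} {AP : Type v}
    [Finite S] [MeasurableSpace S] [DiscreteMeasurableSpace S]
    (P : ProbAutomaton S AP) (serial : ∀ s, ∃ μ : PMF S, (s, μ) ∈ P.step) :
    (∀ i ≥ 1, ∀ s r : S, P.EquivFragment i s r ↔ P.DepthBisimilar i s r) ∧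
      (∀ s r : S, P.EquivPCTLStar s r ↔ P.StrongBisimilar s r) := by
  have := ProbAutomaton.Scheduler.nonempty_of_serial serial
  have equivFragment_iff (i : ℕ) (hi : i ≥ 1) (s r : S) :
      P.EquivFragment i s r ↔ P.DepthBisimilar i s r := by
    obtain ⟨i, rfl⟩ := Nat.exists_eq_add_of_le' hi
    exact ⟨fun h => h.depthBisimilar, fun h => h.equivFragment⟩
  refine ⟨equivFragment_iff, fun s r => ⟨fun h i hi => ?_, fun h => ?_⟩⟩
  · exact (equivFragment_iff i hi s r).1 fun φ _ => h φ
  · refine ProbAutomaton.equivPCTLStar_of_forall_equivFragment fun i => ?_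
    exact (h (i + 1) i.succ_pos).equivFragment.anti i.le_succ
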